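/- Let $K$ be a field of characteristic zero, $I$ a finite non-empty set, and for every $i\in I$ let $F_i=\sum_{p\in\mathbb{N}^I}a^{(i)}_p\prod_{l\in I}h_l^{p_l}\in K[[h_l,\,l\in I]]$ be a non-constant formal series with constant term $1$. Write $(\varepsilon_j)_{j\in I}$ for the canonical basis of $\mathbb{Z}^I$ and $a^{(i)}_j=a^{(i)}_{\varepsilon_j}$. Let $\mathcal{H}_I$ be the Connes–Kreimer Hopf algebra of rooted trees with vertices decorated by $I$: it is the polynomial algebra over $K$ generated by these trees, graded by the number of vertices, with coproduct $\Delta(t)=\sum_c P^c(t)\otimes R^c(t)$ for every tree $t$, where $c$ runs over all admissible cuts of $t$ (the empty and the total cuts included), $R^c(t)$ is the component containing the root and $P^c(t)$ is the product of the other components (for the total cut, $R^c(t)=1$ and $P^c(t)=t$). Let $B^+_i$ be the operator which grafts the trees of a forest on a common root decorated by $i$. The system of Dyson–Schwinger equations (SDSE) associated to $(F_i)_{i\in I}$ is $X_i=B^+_i(F_i(X_j,\,j\in I))$, $i\in I$; it has a unique solution $(X_i)_{i\in I}$ in the completion $\prod_{n\ge 0}\mathcal{H}_I(n)$ of $\mathcal{H}_I$,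 where $\mathcal{H}_I(n)$ is the homogeneous component of degree $n$. The system is called Hopf if the subalgebra of $\mathcal{H}_I$ generated by the homogeneous components $X_i(n)$ of the $X_i$ is a Hopf subalgebra. Then the SDSE is Hopf if and only if there exist scalars $\lambda_n^{(i,j)}\in K$ ($n\ge 1$, $i,j\in I$) satisfying the following two conditions: 1. For all $i,j\in I$ and all $p=(p_l)_{l\in I}\in\mathbb{N}^I$, $$a^{(i)}_{p+\varepsilon_j}=\frac{1}{p_j+1}\left(\lambda^{(i,j)}_{1+\sum_{l\in I}p_l}-\sum_{l\in I}p_l\,a^{(l)}_j\right)a^{(i)}_p.$$ 2. For all $p\ge 1$ and all $i,j,d_1,\dots,d_p\in I$ such that $a^{(i)}_{\varepsilon_{d_1}+\cdots+\varepsilon_{d_p}}\ne 0$, and for all $n_1,\dots,n_p\ge 1$, $$\lambda^{(i,j)}_{n_1+\cdots+n_p+1}-a^{(i)}_j=\lambda^{(i,j)}_{p+1}-a^{(i)}_j+\sum_{l=1}^{p}\left(\lambda^{(d_l,j)}_{n_l}-a^{(d_l)}_j\right).$$ -/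

import Mathlib

open scoped TensorProduct

namespace DysonSchwinger

/-- Planar (ordered) rooted trees whose vertices are decorated by `D`. -/
inductive PTree (D : Type*) : Type _
  | node : D → List (PTree D) → PTree D

namespace PTree

variable {D : Type*}

/-- Elementary identifications of planar trees: permuting the branches at one vertex,
at any depth. -/
inductive Step : PTree D → PTree D → Prop
  | perm (d : D) {l l' : List (PTree D)} : l.Perm l' → Step (node d l) (node d l')
  | child (d : D) (l₁ l₂ : List (PTree D)) {s s' : PTree D} :
      Step s s' → Step (node d (l₁ ++ s :: l₂)) (node d (l₁ ++ s' :: l₂))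

mutual
/-- The number of vertices of a tree. -/
def weight : PTree D → ℕ
  | node _ l => weightList l + 1
/-- The total number of vertices of a list of trees. -/
def weightList : List (PTree D) → ℕ
  | [] => 0
  | s :: l => weight s + weightList l
end

mutual
/-- The list of the pairs `(P^c(t), R^c(t))`, one for each admissible cut `c` of `t` other than
the total cut (the empty cut is included): `R^c(t)` is the component of the root, and `P^c(t)` is
the list of the other components. -/
def cuts : PTree D → List (List (PTree D) × PTree D)
  | node d l => (cutsList l).map fun c => (c.1, node d c.2)
/-- The admissible cuts of a tree with list of branches `l`: for each branch `s`, either the edge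
which joins `s` to the root is cut, and then no edge of `s` can be cut, or this edge is kept, and
an admissible cut of `s` is chosen. The second component is the list of what remains of the
branches attached to the root. -/
def cutsList : List (PTree D) → List (List (PTree D) × List (PTree D))
  | [] => [([], [])]
  | s :: l =>
      ((cutsList l).map fun c => (s :: c.1, c.2)) ++
        (cuts s).flatMap fun b => (cutsList l).map fun c => (b.1 ++ c.1, b.2 :: c.2)
end

theorem weightList_eq (l : List (PTree D)) : weightList l = (l.map weight).sum := by
  induction l with
  | nil => rfl
  | cons s l ih => simp [weightList, ih]

theorem weight_eq_of_step {s t : PTree D} (h : Step s t) : weight s = weight t := by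
  induction h with
  | perm d h =>
    simp only [weight, weightList_eq]
    rw [(h.map weight).sum_eq]
  | child d l₁ l₂ _ ih => simp [weight, weightList_eq, ih]

end PTree

/-- Rooted trees decorated by `D`: planar trees up to permutations of the branches. -/
def RTree (D : Type*) : Type _ := Quot (PTree.Step (D := D))

namespace RTree

variable {D : Type*}

/-- The rooted tree underlying a planar tree. -/
def mk (t : PTree D) : RTree D := Quot.mk _ t

/-- A planar representative of a rooted tree. -/
noncomputable def out (t : RTree D) : PTree D := Quot.out t

theorem mk_out (t : RTree D) : mk t.out = t := Quot.out_eq t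

/-- The number of vertices of a rooted tree. -/
def weight : RTree D → ℕ := Quot.lift PTree.weight fun _ _ h => PTree.weight_eq_of_step h

theorem mk_node_append (d : D) (l₀ l : List (PTree D)) :
    mk (PTree.node d (l₀ ++ (l.map mk).map out)) = mk (PTree.node d (l₀ ++ l)) := by
  induction l generalizing l₀ with
  | nil => rfl
  | cons s l ih =>
    have h1 := ih (l₀ ++ [out (mk s)])
    simp only [List.append_assoc, List.singleton_append] at h1
    simp only [List.map_cons]
    rw [h1]
    have key : ∀ a b : PTree D, Relation.EqvGen PTree.Step a b →
        mk (PTree.node d (l₀ ++ a :: l)) = mk (PTree.node d (l₀ ++ b :: l)) := by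
      intro a b hab
      induction hab with
      | rel a b h => exact Quot.sound (PTree.Step.child d l₀ l h)
      | refl a => rfl
      | symm a b _ ih => exact ih.symm
      | trans a b c _ _ ih1 ih2 => exact ih1.trans ih2
    exact key _ _ (Quot.eqvGen_exact (mk_out (mk s)))

/-- The rooted tree obtained by grafting the trees of the forest `f` on a common root decorated
by `d`. -/
noncomputable def graft (d : D) (f : Multiset (RTree D)) : RTree D :=
  Quot.liftOn f (fun l => mk (PTree.node d (l.map out)))
    fun _ _ h => Quot.sound (PTree.Step.perm d (h.map out))

theorem graft_coe (d : D) (l : List (PTree D)) :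
    graft d (l.map mk : List (RTree D)) = mk (PTree.node d l) :=
  mk_node_append d [] l

end RTree

/-- The polynomial algebra generated by the rooted trees decorated by `D`. Its monomials are the
forests. -/
abbrev TreeAlgebra (K D : Type*) [CommSemiring K] : Type _ := MvPolynomial (RTree D) K

section Coproduct

variable (K : Type*) {D : Type*} [Field K]

/-- The linear operator `B⁺_d`, which grafts the trees of a forest on a common root decorated
by `d`. -/
noncomputable def Bplus (d : D) : TreeAlgebra K D →ₗ[K] TreeAlgebra K D :=
  (MvPolynomial.basisMonomials (RTree D) K).constr K fun f =>
    MvPolynomial.X (RTree.graft d (Finsupp.toMultiset f))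

/-- The tree underlying a planar tree, as an element of the algebra. -/
noncomputable def ofPTree (t : PTree D) : TreeAlgebra K D := MvPolynomial.X (RTree.mk t)

/-- The forest underlying a list of planar trees, as an element of the algebra. -/
noncomputable def ofForest (l : List (PTree D)) : TreeAlgebra K D := (l.map (ofPTree K)).prod

/-- The sum of the `P^c(t) ⊗ R^c(t)` over all admissible cuts `c` of `t`. The first term is given
by the total cut. -/
noncomputable def comulPTree (t : PTree D) : TreeAlgebra K D ⊗[K] TreeAlgebra K D :=
  ofPTree K t ⊗ₜ[K] 1 +
    ((PTree.cuts t).map fun c => ofForest K c.1 ⊗ₜ[K] ofPTree K c.2).sum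

theorem exists_ofForest_eq (l : List (PTree D)) :
    ∃ f : RTree D →₀ ℕ, Finsupp.toMultiset f = (l.map RTree.mk : List (RTree D)) ∧
      ofForest K l = MvPolynomial.basisMonomials (RTree D) K f := by
  rw [MvPolynomial.coe_basisMonomials]
  induction l with
  | nil => exact ⟨0, by simp, by simp [ofForest]⟩
  | cons s l ih =>
    obtain ⟨f, h1, h2⟩ := ih
    refine ⟨Finsupp.single (RTree.mk s) 1 + f, ?_, ?_⟩
    · rw [map_add, h1, Finsupp.toMultiset_single, one_nsmul, List.map_cons, ← Multiset.cons_coe,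
        Multiset.singleton_add]
    · have h : ofForest K (s :: l) = ofPTree K s * ofForest K l := by simp [ofForest]
      rw [h, h2, ofPTree, MvPolynomial.X, MvPolynomial.monomial_mul, one_mul]

theorem Bplus_ofForest (d : D) (l : List (PTree D)) :
    Bplus K d (ofForest K l) = ofPTree K (PTree.node d l) := by
  obtain ⟨f, h1, h2⟩ := exists_ofForest_eq K l
  rw [h2, Bplus, Module.Basis.constr_basis, h1, RTree.graft_coe, ofPTree]

theorem sum_cutsList (l : List (PTree D)) :
    ((PTree.cutsList l).map fun c => ofForest K c.1 ⊗ₜ[K] ofForest K c.2).sum =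
      (l.map (comulPTree K)).prod := by
  induction l with
  | nil => simp [PTree.cutsList, ofForest, Algebra.TensorProduct.one_def]
  | cons s l ih =>
    have hc : ∀ (t : PTree D) (m : List (PTree D)),
        ofForest K (t :: m) = ofPTree K t * ofForest K m := by simp [ofForest]
    have ha : ∀ m m' : List (PTree D),
        ofForest K (m ++ m') = ofForest K m * ofForest K m' := by simp [ofForest]
    have h1 : ∀ L : List (List (PTree D) × PTree D),
        ((L.flatMap fun b => (PTree.cutsList l).map fun c => (b.1 ++ c.1, b.2 :: c.2)).map
          fun c => ofForest K c.1 ⊗ₜ[K] ofForest K c.2).sum =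
        (L.map fun c => ofForest K c.1 ⊗ₜ[K] ofPTree K c.2).sum * (l.map (comulPTree K)).prod := by
      intro L
      induction L with
      | nil => simp
      | cons b L ihL =>
        rw [List.flatMap_cons, List.map_append, List.sum_append, ihL, List.map_cons,
          List.sum_cons, add_mul]
        congr 1
        rw [← ih, ← List.sum_map_mul_left, List.map_map]
        congr 1
        refine List.map_congr_left fun c _ => ?_
        simp [hc, ha]
    rw [PTree.cutsList, List.map_append, List.sum_append, h1, List.map_cons, List.prod_cons,
      comulPTree, add_mul]
    congr 1
    rw [← ih, ← List.sum_map_mul_left, List.map_map]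
    congr 1
    refine List.map_congr_left fun c _ => ?_
    simp [hc]

theorem comulPTree_node (d : D) (l : List (PTree D)) :
    comulPTree K (PTree.node d l) = ofPTree K (PTree.node d l) ⊗ₜ[K] 1 +
      (Bplus K d).lTensor (TreeAlgebra K D) (l.map (comulPTree K)).prod := by
  rw [comulPTree, ← sum_cutsList, map_list_sum, PTree.cuts, List.map_map, List.map_map]
  congr 2
  refine List.map_congr_left fun c _ => ?_
  simp [Bplus_ofForest]

theorem ofPTree_eq_of_step {s t : PTree D} (h : PTree.Step s t) : ofPTree K s = ofPTree K t := by
  rw [ofPTree, ofPTree]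
  exact congrArg _ (Quot.sound h)

theorem comulPTree_eq_of_step {s t : PTree D} (h : PTree.Step s t) :
    comulPTree K s = comulPTree K t := by
  induction h with
  | perm d h =>
    rw [comulPTree_node, comulPTree_node, ofPTree_eq_of_step K (PTree.Step.perm d h),
      (h.map (comulPTree K)).prod_eq]
  | child d l₁ l₂ h ih =>
    rw [comulPTree_node, comulPTree_node, ofPTree_eq_of_step K (PTree.Step.child d l₁ l₂ h)]
    simp [ih]

/-- The coproduct: the algebra morphism which sends a tree `t` to the sum of the
`P^c(t) ⊗ R^c(t)` over all admissible cuts `c` of `t`. -/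
noncomputable def comul : TreeAlgebra K D →ₐ[K] TreeAlgebra K D ⊗[K] TreeAlgebra K D :=
  MvPolynomial.aeval (Quot.lift (comulPTree K) fun _ _ h => comulPTree_eq_of_step K h)

/-- `S` is the antipode, that is to say the inverse of the identity for the convolution product.
The counit sends every nonempty forest to `0`. -/
def IsAntipode (S : TreeAlgebra K D →ₗ[K] TreeAlgebra K D) : Prop :=
  (∀ x, LinearMap.mul' K (TreeAlgebra K D) (TensorProduct.map S LinearMap.id (comul K x)) =
      MvPolynomial.C (MvPolynomial.constantCoeff x)) ∧
    ∀ x, LinearMap.mul' K (TreeAlgebra K D) (TensorProduct.map LinearMap.id S (comul K x)) =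
      MvPolynomial.C (MvPolynomial.constantCoeff x)

/-- A subalgebra `A` is a Hopf subalgebra if `Δ(A) ⊆ A ⊗ A` and if `A` is stable under the
antipode. -/
def IsHopfSubalgebra (A : Subalgebra K (TreeAlgebra K D)) : Prop :=
  (∀ x ∈ A, comul K x ∈
      LinearMap.range (TensorProduct.map A.val.toLinearMap A.val.toLinearMap)) ∧
    ∃ S : TreeAlgebra K D →ₗ[K] TreeAlgebra K D, IsAntipode K S ∧ ∀ x ∈ A, S x ∈ A

end Coproduct

section System

variable {K I : Type*} [Field K]

/-- The completion `∏ₙ H(n)` is the set of the formal series `∑ xₙ zⁿ`, where `xₙ` is a linear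
combination of forests with `n` vertices. The power of `z` only records the degree, and the
product is the product of power series. -/
def IsGraded (x : PowerSeries (TreeAlgebra K I)) : Prop :=
  ∀ n, MvPolynomial.IsWeightedHomogeneous RTree.weight (PowerSeries.coeff n x) n

/-- The extension of `B⁺_d` to the completion. It is homogeneous of degree `1`. -/
noncomputable def BplusHat (d : I) (x : PowerSeries (TreeAlgebra K I)) :
    PowerSeries (TreeAlgebra K I) :=
  PowerSeries.mk fun n => Nat.casesOn n 0 fun m => Bplus K d (PowerSeries.coeff m x)

/-- `X` is a solution of the system `X_i = B⁺_i(F_i(X_j, j ∈ I))`, `i ∈ I`, in the completion. Any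
such `X` has zero constant terms, so that the substitution makes sense when `I` is finite. -/
def IsSolution (F : I → MvPowerSeries I K) (X : I → PowerSeries (TreeAlgebra K I)) : Prop :=
  (∀ i, IsGraded (X i)) ∧ ∀ i, X i = BplusHat i (MvPowerSeries.subst X (F i))

/-- The subalgebra generated by the homogeneous components of the `X_i`. -/
noncomputable def generatedSubalgebra (X : I → PowerSeries (TreeAlgebra K I)) :
    Subalgebra K (TreeAlgebra K I) :=
  Algebra.adjoin K {x | ∃ i n, x = PowerSeries.coeff n (X i)}

/-- The system associated to `F` is Hopf if the subalgebra generated by the homogeneous components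
of its (unique) solution is a Hopf subalgebra. -/
def IsHopf (F : I → MvPowerSeries I K) : Prop :=
  ∃ X : I → PowerSeries (TreeAlgebra K I), IsSolution F X ∧
    IsHopfSubalgebra K (generatedSubalgebra X)

/-- The coefficient `a^{(i)}_p` of the monomial `∏ h_l^{p_l}` in `F_i`. -/
noncomputable def a (F : I → MvPowerSeries I K) (i : I) (p : I →₀ ℕ) : K :=
  MvPowerSeries.coeff p (F i)

/-- The coefficient `a^{(i)}_j` of `h_j` in `F_i`. -/
noncomputable def a₁ (F : I → MvPowerSeries I K) (i j : I) : K := a F i (Finsupp.single j 1)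

end System

end DysonSchwinger

/-!
Together, the two conditions amount to a single functional equation. For scalars `c`, let `scale c`
be the operator which multiplies the coefficient of `zⁿ` by `c n`. If the two conditions hold, then
for all series `Y_k` without constant terms (`subst_functional_equation`)

  `∑ₖ (∂ₖF_i)(Y) (δ_{kj} + scale λ^{(k,j)} Y_k) = scale λ^{(i,j)}_{· + 1} F_i(Y)`.

**The conditions are necessary.** A Hopf subalgebra is stable under the derivation `D_j` which
removes a leaf decorated by `j`, because `D_j` is a contraction of the coproduct. On the component
`X_i(n + 1)` this gives a combination of trees with `n` vertices and root `i`, hence a multiple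
`λ_n^{(i,j)} X_i(n)` (`exists_mapDerivation_eq`). As `X_i = B⁺_i(F_i(X))`, the chain rule
gives the functional equation for `Y = X` (`functional_equation_of_mapDerivation`). The trees are
algebraically independent, so that the equation can be differentiated with respect to a list of
trees which occur in `X`; at the origin, this gives (`coeff_relation`)

  `(p_j + 1) a_{p + ε_j} + (∑_t λ_{|t|}^{(root t, j)}) a_p = λ_{|t₁| + ⋯ + |tₘ| + 1}^{(i,j)} a_p`,

where `p` is the sum of the `ε_{root t}`. Single vertices yield the first condition. Comparing them
with larger trees yields the second one, since the first condition and the hypothesis that the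
`F_i` are not constant provide trees of every weight with every root
(`exists_treeCoeff_ne_zero`).

**The conditions are sufficient.** Choose `d i` with `a^{(i)}_{d i} ≠ 0`, and let
`P_0^{(i)} = F_i` and `P_{n+1}^{(i)} = (∂_{d i}F_i) P_n^{(d i)} / a^{(i)}_{d i}` be the transfer
series. The linearization of the functional equation shows that `P_n^{(i)}` satisfies the same
equation, with the scalars `λ` shifted by `n` (`subst_transfer_functional_equation`). For a generic
series `U`, these equations say that the two sides of

  `F_i(U_k + z ∑ₙ zⁿ P_n^{(k)}(U) V_k(n + 1)) = ∑ₙ zⁿ P_n^{(i)}(U) [zⁿ]F_i(V)`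

are solutions of the same differential system, whose solutions are determined by their values at
`U = 0`, where both sides are `F_i(V)` (`subst_add_twist`). Now `B⁺_i` is a cocycle, so that `Δ(X)`
is the only fixed point of `Y ↦ X_i ⊗ 1 + (id ⊗ B⁺_i)(F_i(Y))`, and the identity above exhibits the
fixed point `X_i ⊗ 1 + ∑ₙ P_n^{(i)}(X) ⊗ X_i(n + 1)` (`coeff_comul_solution`). Hence the subalgebra
is stable under the coproduct, and by induction on the degree under the antipode.
-/

namespace DysonSchwinger

/-! ### Substitution in formal series -/

section Subst

variable {K σ R : Type*} [Field K] [CommRing R] [Algebra K R]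

theorem coeff_monomial_subst_eq_zero [Finite σ] {Y : σ → PowerSeries R}
    (hY : ∀ k, PowerSeries.constantCoeff (Y k) = 0) {p : σ →₀ ℕ} {n : ℕ} (h : n < p.degree) :
    PowerSeries.coeff n (p.prod fun k e => Y k ^ e) = 0 := by
  have hd : (PowerSeries.X : PowerSeries R) ^ p.degree ∣ p.prod fun k e => Y k ^ e := by
    rw [Finsupp.degree_apply, Finsupp.prod, ← Finset.prod_pow_eq_pow_sum]
    exact Finset.prod_dvd_prod_of_dvd _ _ fun k _ =>
      pow_dvd_pow_of_dvd (PowerSeries.X_dvd_iff.mpr (hY k)) _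
  exact PowerSeries.X_pow_dvd_iff.mp hd n h

theorem hasSubst_of_forall [Finite σ] {Y : σ → PowerSeries R}
    (hY : ∀ k, PowerSeries.constantCoeff (Y k) = 0) : MvPowerSeries.HasSubst Y :=
  MvPowerSeries.hasSubst_of_constantCoeff_zero hY

variable [Finite σ] {Y : σ → PowerSeries R}

/-- Only the monomials of degree at most `n` contribute to the coefficient of `zⁿ` of a
substitution. -/
theorem coeff_subst_eq_sum (hY : ∀ k, PowerSeries.constantCoeff (Y k) = 0)
    (F : MvPowerSeries σ K) {n N : ℕ} (h : n < N) :
    PowerSeries.coeff n (MvPowerSeries.subst Y F : PowerSeries R) =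
      ∑ p ∈ (Finsupp.finite_of_degree_lt (σ := σ) N).toFinset,
        MvPowerSeries.coeff p F • PowerSeries.coeff n (p.prod fun k e => Y k ^ e) := by
  rw [PowerSeries.coeff, MvPowerSeries.coeff_subst (hasSubst_of_forall hY),
    finsum_eq_sum_of_support_subset]
  · intro p hp
    by_contra hpN
    have hpN' : n < p.degree := by
      have : ¬ p.degree < N := by simpa using hpN
      omega
    refine hp ?_
    beta_reduce
    have := coeff_monomial_subst_eq_zero hY hpN'
    rw [PowerSeries.coeff] at this
    rw [this, smul_zero]

theorem coeff_subst_eq_aeval_truncTotal (hY : ∀ k, PowerSeries.constantCoeff (Y k) = 0)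
    (F : MvPowerSeries σ K) {n N : ℕ} (h : n < N) :
    PowerSeries.coeff n (MvPowerSeries.subst Y F : PowerSeries R) =
      PowerSeries.coeff n (MvPolynomial.aeval Y (MvPowerSeries.truncTotal N F)) := by
  rw [← MvPowerSeries.subst_coe, coeff_subst_eq_sum hY F h, coeff_subst_eq_sum hY _ h]
  refine Finset.sum_congr rfl fun p hp => ?_
  have hp' : p.degree < N := by simpa using hp
  rw [MvPolynomial.coeff_coe, MvPowerSeries.coeff_truncTotal _ hp']

theorem coeff_subst_congr (hY : ∀ k, PowerSeries.constantCoeff (Y k) = 0)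
    {F G : MvPowerSeries σ K} {n : ℕ}
    (h : ∀ p : σ →₀ ℕ, p.degree ≤ n → MvPowerSeries.coeff p F = MvPowerSeries.coeff p G) :
    PowerSeries.coeff n (MvPowerSeries.subst Y F : PowerSeries R) =
      PowerSeries.coeff n (MvPowerSeries.subst Y G : PowerSeries R) := by
  rw [coeff_subst_eq_sum hY F n.lt_succ_self, coeff_subst_eq_sum hY G n.lt_succ_self]
  refine Finset.sum_congr rfl fun p hp => ?_
  have hp' : p.degree < n + 1 := by simpa using hp
  rw [h p (by omega)]

theorem constantCoeff_subst_eq (hY : ∀ k, PowerSeries.constantCoeff (Y k) = 0)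
    (F : MvPowerSeries σ K) :
    PowerSeries.constantCoeff (MvPowerSeries.subst Y F : PowerSeries R) =
      algebraMap K R (MvPowerSeries.constantCoeff F) := by
  have h : ∀ p : σ →₀ ℕ, p.degree ≤ 0 →
      MvPowerSeries.coeff p F =
        MvPowerSeries.coeff p (MvPowerSeries.C (MvPowerSeries.constantCoeff F)) := by
    intro p hp
    have : p = 0 := (Finsupp.degree_eq_zero_iff p).mp (by omega)
    subst this
    simp
  have h2 := coeff_subst_congr (R := R) hY h
  rw [PowerSeries.coeff_zero_eq_constantCoeff_apply,
    PowerSeries.coeff_zero_eq_constantCoeff_apply] at h2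
  rw [h2]
  have h3 : (MvPowerSeries.C (MvPowerSeries.constantCoeff F) : MvPowerSeries σ K) =
      ((MvPolynomial.C (MvPowerSeries.constantCoeff F) : MvPolynomial σ K) :
        MvPowerSeries σ K) := by simp
  rw [h3, MvPowerSeries.subst_coe, MvPolynomial.aeval_C]
  rfl

/-- The coefficient of `zⁿ` of `F(Y)` only depends on the coefficients of `Y` up to `zⁿ`. -/
theorem coeff_subst_congr_left {Y Z : σ → PowerSeries R}
    (hY : ∀ k, PowerSeries.constantCoeff (Y k) = 0)
    (hZ : ∀ k, PowerSeries.constantCoeff (Z k) = 0) (F : MvPowerSeries σ K) {n : ℕ}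
    (h : ∀ m ≤ n, ∀ k, PowerSeries.coeff m (Y k) = PowerSeries.coeff m (Z k)) :
    PowerSeries.coeff n (MvPowerSeries.subst Y F : PowerSeries R) =
      PowerSeries.coeff n (MvPowerSeries.subst Z F : PowerSeries R) := by
  have key : ∀ q : MvPolynomial σ K, PowerSeries.trunc (n + 1) (MvPolynomial.aeval Y q) =
      PowerSeries.trunc (n + 1) (MvPolynomial.aeval Z q) := by
    intro q
    induction q using MvPolynomial.induction_on with
    | C a => simp
    | add p q hp hq => simp [hp, hq]
    | mul_X p k hp =>
      have hk : PowerSeries.trunc (n + 1) (Y k) = PowerSeries.trunc (n + 1) (Z k) := by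
        ext m
        rw [PowerSeries.coeff_trunc, PowerSeries.coeff_trunc]
        split_ifs with hm
        · exact h m (by omega) k
        · rfl
      rw [map_mul (MvPolynomial.aeval Y), map_mul (MvPolynomial.aeval Z), MvPolynomial.aeval_X,
        MvPolynomial.aeval_X, ← PowerSeries.trunc_trunc_mul_trunc, hp, hk,
          PowerSeries.trunc_trunc_mul_trunc]
  have h2 := congrArg (fun q => Polynomial.coeff q n) (key (MvPowerSeries.truncTotal (n + 1) F))
  simp only [PowerSeries.coeff_trunc, Nat.lt_succ_self, if_true] at h2
  rw [coeff_subst_eq_aeval_truncTotal hY F n.lt_succ_self,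
    coeff_subst_eq_aeval_truncTotal hZ F n.lt_succ_self, h2]

theorem map_subst_algHom (hY : ∀ k, PowerSeries.constantCoeff (Y k) = 0)
    {S : Type*} [CommRing S] [Algebra K S] (φ : R →ₐ[K] S)
    (F : MvPowerSeries σ K) :
    PowerSeries.map (φ : R →+* S) (MvPowerSeries.subst Y F) =
      MvPowerSeries.subst (fun k => PowerSeries.map (φ : R →+* S) (Y k)) F := by
  have hY' : ∀ k, PowerSeries.constantCoeff (PowerSeries.map (φ : R →+* S) (Y k)) = 0 := by
    intro k
    rw [← PowerSeries.coeff_zero_eq_constantCoeff_apply, PowerSeries.coeff_map,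
      PowerSeries.coeff_zero_eq_constantCoeff_apply, hY, map_zero]
  ext n
  rw [PowerSeries.coeff_map, coeff_subst_eq_sum hY F n.lt_succ_self,
    coeff_subst_eq_sum hY' F n.lt_succ_self, map_sum]
  refine Finset.sum_congr rfl fun p _ => ?_
  rw [RingHom.coe_coe, map_smul, ← RingHom.coe_coe φ, ← PowerSeries.coeff_map, Finsupp.prod,
    map_prod, Finsupp.prod]
  simp

/-- A subalgebra which contains the coefficients of the `Y_k` contains the coefficients of
`F(Y)`. -/
theorem coeff_subst_mem (hY : ∀ k, PowerSeries.constantCoeff (Y k) = 0)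
    (A : Subalgebra K R) (hA : ∀ k n, PowerSeries.coeff n (Y k) ∈ A)
    (F : MvPowerSeries σ K) (n : ℕ) :
    PowerSeries.coeff n (MvPowerSeries.subst Y F : PowerSeries R) ∈ A := by
  have key : ∀ q : MvPolynomial σ K, ∀ n, PowerSeries.coeff n (MvPolynomial.aeval Y q) ∈ A := by
    intro q
    induction q using MvPolynomial.induction_on with
    | C a =>
      intro n
      rw [MvPolynomial.aeval_C, PowerSeries.algebraMap_apply, PowerSeries.coeff_C]
      split_ifs
      · exact A.algebraMap_mem a
      · exact A.zero_mem
    | add p q hp hq => intro n; rw [map_add, map_add]; exact A.add_mem (hp n) (hq n)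
    | mul_X p k hp =>
      intro n
      rw [map_mul, PowerSeries.coeff_mul, MvPolynomial.aeval_X]
      exact A.sum_mem fun c _ => A.mul_mem (hp _) (hA _ _)
  rw [coeff_subst_eq_aeval_truncTotal hY F n.lt_succ_self]
  exact key _ n

end Subst

/-! ### Coefficientwise operators on power series -/

section Coefficientwise

variable {K R : Type*} [Field K] [CommRing R] [Algebra K R]

/-- The operator which multiplies the coefficient of `zⁿ` by `c n`. -/
noncomputable def scale (c : ℕ → K) : PowerSeries R →ₗ[K] PowerSeries R where
  toFun f := PowerSeries.mk fun n => c n • PowerSeries.coeff n f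
  map_add' f g := by ext n; simp
  map_smul' r f := by ext n; simpa using smul_comm _ _ _

@[simp]
theorem coeff_scale (c : ℕ → K) (f : PowerSeries R) (n : ℕ) :
    PowerSeries.coeff n (scale c f) = c n • PowerSeries.coeff n f := by
  simp [scale]

theorem scale_X_pow_mul (c : ℕ → K) (f : PowerSeries R) (n : ℕ) :
    scale c (PowerSeries.X ^ n * f) = PowerSeries.X ^ n * scale (fun m => c (m + n)) f := by
  ext m
  rw [coeff_scale, PowerSeries.coeff_X_pow_mul', PowerSeries.coeff_X_pow_mul']
  split_ifs with h
  · rw [coeff_scale, Nat.sub_add_cancel h]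
  · rw [smul_zero]

/-- The extension of a derivation to power series, coefficient by coefficient. -/
noncomputable def mapDerivation (D : Derivation K R R) :
    Derivation K (PowerSeries R) (PowerSeries R) :=
  Derivation.mk'
    { toFun := fun f => PowerSeries.mk fun n => D (PowerSeries.coeff n f)
      map_add' := fun f g => by ext n; simp
      map_smul' := fun r f => by ext n; simp }
    (fun f g => by
      ext n
      simp only [LinearMap.coe_mk, AddHom.coe_mk, PowerSeries.coeff_mk, PowerSeries.coeff_mul,
        map_sum, Derivation.leibniz, smul_eq_mul, map_add, Finset.sum_add_distrib]
      congr 1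
      exact Finset.Nat.sum_antidiagonal_swap
        (f := fun c => PowerSeries.coeff c.1 g * D (PowerSeries.coeff c.2 f)))

@[simp]
theorem coeff_mapDerivation (D : Derivation K R R) (f : PowerSeries R) (n : ℕ) :
    PowerSeries.coeff n (mapDerivation D f) = D (PowerSeries.coeff n f) := by
  simp [mapDerivation]

theorem mapDerivation_scale (D : Derivation K R R) (c : ℕ → K) (f : PowerSeries R) :
    mapDerivation D (scale c f) = scale c (mapDerivation D f) := by
  ext n
  simp

theorem mapDerivation_X_pow (D : Derivation K R R) (n : ℕ) :
    mapDerivation D (PowerSeries.X ^ n) = 0 := by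
  ext m
  rw [coeff_mapDerivation, PowerSeries.coeff_X_pow]
  split_ifs <;> simp

theorem map_scale {S : Type*} [CommRing S] [Algebra K S] (φ : R →ₐ[K] S) (c : ℕ → K)
    (f : PowerSeries R) :
    PowerSeries.map (φ : R →+* S) (scale c f) = scale c (PowerSeries.map (φ : R →+* S) f) := by
  ext n
  simp

end Coefficientwise

section ChainRule

variable {K σ R : Type*} [Field K] [CommRing R] [Algebra K R] [Fintype σ]

theorem derivation_aeval (D : Derivation K R R) (Y : σ → R) (q : MvPolynomial σ K) :
    D (MvPolynomial.aeval Y q) =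
      ∑ k, MvPolynomial.aeval Y (MvPolynomial.pderiv k q) * D (Y k) := by
  induction q using MvPolynomial.induction_on with
  | C a => simp
  | add p q hp hq => simp [hp, hq, add_mul, Finset.sum_add_distrib]
  | mul_X p l hp =>
    classical
    simp only [map_mul, MvPolynomial.aeval_X, Derivation.leibniz, hp, smul_eq_mul, map_add,
      MvPolynomial.pderiv_X, add_mul, Finset.sum_add_distrib]
    congr 1
    · rw [Finset.sum_eq_single l]
      · simp
      · intro k _ hk
        simp [Pi.single_eq_of_ne hk.symm]
      · simp
    · rw [Finset.mul_sum]
      exact Finset.sum_congr rfl fun k _ => by ring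

theorem coeff_subst_pderiv_eq_aeval {Y : σ → PowerSeries R}
    (hY : ∀ k, PowerSeries.constantCoeff (Y k) = 0) (F : MvPowerSeries σ K) (k : σ) {n N : ℕ}
    (h : n + 1 < N) :
    PowerSeries.coeff n (MvPowerSeries.subst Y (MvPowerSeries.pderiv K k F) : PowerSeries R) =
      PowerSeries.coeff n
        (MvPolynomial.aeval Y (MvPolynomial.pderiv k (MvPowerSeries.truncTotal N F))) := by
  rw [← MvPowerSeries.subst_coe, ← MvPowerSeries.pderiv_coe]
  refine coeff_subst_congr hY fun p hp => ?_
  rw [MvPowerSeries.coeff_pderiv, MvPowerSeries.coeff_pderiv, MvPolynomial.coeff_coe,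
    MvPowerSeries.coeff_truncTotal]
  rw [map_add, Finsupp.degree_single]
  omega

theorem coeff_sum_subst_pderiv_mul {Y : σ → PowerSeries R}
    (hY : ∀ k, PowerSeries.constantCoeff (Y k) = 0) (F : MvPowerSeries σ K)
    (V : σ → PowerSeries R) {n N : ℕ} (h : n + 1 < N) :
    PowerSeries.coeff n (∑ k, MvPowerSeries.subst Y (MvPowerSeries.pderiv K k F) * V k) =
      PowerSeries.coeff n (∑ k,
        MvPolynomial.aeval Y (MvPolynomial.pderiv k (MvPowerSeries.truncTotal N F)) * V k) := by
  rw [map_sum, map_sum]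
  refine Finset.sum_congr rfl fun k _ => ?_
  rw [PowerSeries.coeff_mul, PowerSeries.coeff_mul]
  refine Finset.sum_congr rfl fun c hc => ?_
  have := Finset.HasAntidiagonal.mem_antidiagonal.mp hc
  rw [coeff_subst_pderiv_eq_aeval hY F k (by omega : c.1 + 1 < N)]

/-- The chain rule. -/
theorem mapDerivation_subst {Y : σ → PowerSeries R}
    (hY : ∀ k, PowerSeries.constantCoeff (Y k) = 0) (D : Derivation K R R)
    (F : MvPowerSeries σ K) :
    mapDerivation D (MvPowerSeries.subst Y F) =
      ∑ k, MvPowerSeries.subst Y (MvPowerSeries.pderiv K k F) * mapDerivation D (Y k) := by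
  ext n
  have h1 := congrArg (PowerSeries.coeff n)
    (derivation_aeval (mapDerivation D) Y (MvPowerSeries.truncTotal (n + 2) F))
  rw [coeff_mapDerivation, ← coeff_subst_eq_aeval_truncTotal hY F (by omega : n < n + 2)] at h1
  rw [coeff_mapDerivation, h1, coeff_sum_subst_pderiv_mul hY F _ (by omega : n + 1 < n + 2)]

end ChainRule

/-! ### The functional equation equivalent to the two conditions -/

section Words

variable {K σ R : Type*} [Field K] [CommRing R] [Algebra K R]

theorem exists_word (p : σ →₀ ℕ) :
    ∃ (m : ℕ) (d : Fin m → σ), ∑ l, Finsupp.single (d l) 1 = p := by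
  induction p using Finsupp.induction_linear with
  | zero => exact ⟨0, Fin.elim0, by simp⟩
  | add p q hp hq =>
    obtain ⟨m, d, rfl⟩ := hp
    obtain ⟨n, e, rfl⟩ := hq
    exact ⟨m + n, Fin.append d e, by simp [Fin.sum_univ_add]⟩
  | single s n => exact ⟨n, fun _ => s, by simp⟩

theorem degree_sum_single {m : ℕ} (d : Fin m → σ) :
    (∑ l, Finsupp.single (d l) 1 : σ →₀ ℕ).degree = m := by
  simp

theorem sum_sum_single_mul [Fintype σ] {m : ℕ} (d : Fin m → σ) (f : σ → K) :
    ∑ k, (((∑ l, Finsupp.single (d l) 1 : σ →₀ ℕ) k : ℕ) : K) * f k = ∑ l, f (d l) := by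
  classical
  simp only [Finsupp.finsetSum_apply, Nat.cast_sum, Finset.sum_mul]
  rw [Finset.sum_comm]
  refine Finset.sum_congr rfl fun l _ => ?_
  simp [Finsupp.single_apply]

theorem sum_pderiv_prod_X [Fintype σ] {ι : Type*} [DecidableEq ι] (Y V : σ → R) (s : Finset ι)
    (d : ι → σ) :
    ∑ k, MvPolynomial.aeval Y (MvPolynomial.pderiv k
      (∏ l ∈ s, (MvPolynomial.X (d l) : MvPolynomial σ K))) * V k =
      ∑ l ∈ s, (∏ l' ∈ s.erase l, Y (d l')) * V (d l) := by
  classical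
  induction s using Finset.induction_on with
  | empty => simp
  | insert a s ha ih =>
    rw [Finset.sum_insert ha, Finset.erase_insert ha, Finset.prod_insert ha]
    simp only [Derivation.leibniz, smul_eq_mul, map_add, map_mul, MvPolynomial.aeval_X, add_mul,
      Finset.sum_add_distrib, MvPolynomial.pderiv_X]
    rw [add_comm]
    congr 1
    · rw [Finset.sum_eq_single (d a)]
      · simp
      · intro k _ hk
        simp [Pi.single_eq_of_ne hk.symm]
      · simp
    · simp only [mul_assoc]
      rw [← Finset.mul_sum, ih, Finset.mul_sum]
      refine Finset.sum_congr rfl fun l hl => ?_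
      have hla : l ≠ a := fun h => ha (h ▸ hl)
      rw [Finset.erase_insert_of_ne hla.symm,
        Finset.prod_insert (fun h => ha (Finset.mem_of_mem_erase h)), mul_assoc]

/-- If `c (n₁ + ⋯ + nₘ) = b + g₁(n₁) + ⋯ + gₘ(nₘ)`, then the operator which multiplies the
coefficients by `c` acts on products of `m` series without constant term as the sum of the scalar
`b` and of the actions of the `gₗ` on the factors. -/
theorem scale_prod {ι : Type*} [Fintype ι] [DecidableEq ι] (W : ι → PowerSeries R)
    (hW : ∀ l, PowerSeries.constantCoeff (W l) = 0) (c : ℕ → K) (b : K) (g : ι → ℕ → K)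
    (h : ∀ n : ι → ℕ, (∀ l, 1 ≤ n l) → c (∑ l, n l) = b + ∑ l, g l (n l)) :
    scale c (∏ l, W l) =
      b • ∏ l, W l + ∑ l, (∏ l' ∈ Finset.univ.erase l, W l') * scale (g l) (W l) := by
  have h1 : ∀ l, (∏ l' ∈ Finset.univ.erase l, W l') * scale (g l) (W l) =
      ∏ l', Function.update W l (scale (g l) (W l)) l' := by
    intro l
    rw [← Finset.mul_prod_erase Finset.univ _ (Finset.mem_univ l), Function.update_self, mul_comm]
    congr 1
    refine Finset.prod_congr rfl fun l' hl' => ?_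
    rw [Function.update_of_ne (Finset.ne_of_mem_erase hl')]
  ext N
  simp only [h1, coeff_scale, map_add, map_sum, PowerSeries.coeff_smul, PowerSeries.coeff_prod]
  rw [Finset.sum_comm, Finset.smul_sum, Finset.smul_sum, ← Finset.sum_add_distrib]
  refine Finset.sum_congr rfl fun n hn => ?_
  have h2 : ∀ l, ∏ l', PowerSeries.coeff (n l') (Function.update W l (scale (g l) (W l)) l') =
      g l (n l) • ∏ l', PowerSeries.coeff (n l') (W l') := by
    intro l
    rw [← Finset.mul_prod_erase Finset.univ _ (Finset.mem_univ l), Function.update_self,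
      ← Finset.mul_prod_erase Finset.univ (fun l' => PowerSeries.coeff (n l') (W l'))
        (Finset.mem_univ l), coeff_scale, smul_mul_assoc]
    congr 2
    refine Finset.prod_congr rfl fun l' hl' => ?_
    rw [Function.update_of_ne (Finset.ne_of_mem_erase hl')]
  simp only [h2]
  by_cases hpos : ∀ l, 1 ≤ n l
  · have hN : ∑ l, n l = N := (Finset.mem_finsuppAntidiag.mp hn).1
    rw [← hN, h n hpos, add_smul, Finset.sum_smul]
  · push Not at hpos
    obtain ⟨l, hl⟩ := hpos
    have hl0 : n l = 0 := by omega
    have h0 : ∏ l', PowerSeries.coeff (n l') (W l') = 0 := by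
      refine Finset.prod_eq_zero (Finset.mem_univ l) ?_
      rw [hl0, PowerSeries.coeff_zero_eq_constantCoeff_apply, hW]
    simp [h0]

end Words

section FunctionalEquation

variable {K I : Type*} [Field K] [Fintype I]

/-- The first condition: a recursion for the coefficients of the `F_i`. -/
def CoeffRecursion (F : I → MvPowerSeries I K) (lam : ℕ → I → I → K) : Prop :=
  ∀ (i j : I) (p : I →₀ ℕ),
    a F i (p + Finsupp.single j 1) =
      1 / ((p j : K) + 1) * (lam ((∑ l, p l) + 1) i j - ∑ l, (p l : K) * a₁ F l j) * a F i p

/-- The second condition: an additivity property of the scalars `λ`. -/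
def Additivity (F : I → MvPowerSeries I K) (lam : ℕ → I → I → K) : Prop :=
  ∀ (p : ℕ), 1 ≤ p → ∀ (i j : I) (d : Fin p → I),
    a F i (∑ l, Finsupp.single (d l) 1) ≠ 0 →
    ∀ n : Fin p → ℕ, (∀ l, 1 ≤ n l) →
      lam ((∑ l, n l) + 1) i j - a₁ F i j =
        (lam (p + 1) i j - a₁ F i j) + ∑ l, (lam (n l) (d l) j - a₁ F (d l) j)

variable {F : I → MvPowerSeries I K} {lam : ℕ → I → I → K}

theorem CoeffRecursion.mul_eq [CharZero K] (h1 : CoeffRecursion F lam) (i j : I) (p : I →₀ ℕ) :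
    a F i (p + Finsupp.single j 1) * ((p j : K) + 1) =
      (lam (p.degree + 1) i j - ∑ l, (p l : K) * a₁ F l j) * a F i p := by
  have h : ((p j : K) + 1) ≠ 0 := by exact_mod_cast (p j).succ_ne_zero
  rw [h1 i j p, Finsupp.degree_eq_sum]
  field_simp

variable {R : Type*} [CommRing R] [Algebra K R]

/-- The additivity of the `λ` says that multiplying the component of degree `n` of a monomial of
`F_i(Y)` by `λ_{n+1}^{(i,j)}` is, up to a multiple of the identity, a derivation. -/
theorem scale_monomial (h2 : Additivity F lam)
    {Y : I → PowerSeries R} (hY : ∀ k, PowerSeries.constantCoeff (Y k) = 0) (i j : I)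
    {p : I →₀ ℕ} (hp : a F i p ≠ 0) :
    scale (fun n => lam (n + 1) i j) (MvPolynomial.aeval Y (MvPolynomial.monomial p (1 : K))) =
      (lam (p.degree + 1) i j - ∑ l, (p l : K) * a₁ F l j) •
          MvPolynomial.aeval Y (MvPolynomial.monomial p (1 : K)) +
        ∑ k, MvPolynomial.aeval Y (MvPolynomial.pderiv k (MvPolynomial.monomial p (1 : K))) *
          scale (fun n => lam n k j) (Y k) := by
  classical
  obtain ⟨m, d, rfl⟩ := exists_word p
  have hmon : MvPolynomial.monomial (∑ l, Finsupp.single (d l) 1) (1 : K) =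
      ∏ l, MvPolynomial.X (d l) := by
    rw [MvPolynomial.monomial_sum_one]
    rfl
  rw [hmon, sum_pderiv_prod_X, map_prod, degree_sum_single, sum_sum_single_mul]
  simp only [MvPolynomial.aeval_X]
  refine scale_prod (fun l => Y (d l)) (fun l => hY (d l)) _ _ (fun l n => lam n (d l) j) ?_
  intro n hn
  rcases Nat.eq_zero_or_pos m with rfl | hm
  · simp
  · have h3 := h2 m hm i j d hp n hn
    rw [Finset.sum_sub_distrib] at h3
    linear_combination h3

/-- The functional equation of the series `F_i`, a reformulation of the two conditions. It holds for
every substitution `Y`. When `Y` is the solution of the system, its left-hand side counts the ways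
to remove a leaf decorated by `j` from the forests of `F_i(Y)`: the leaf is either a whole tree,
hence the term `δ_{kj}`, or it belongs to a larger tree. -/
theorem subst_functional_equation [CharZero K] [DecidableEq I] (h1 : CoeffRecursion F lam)
    (h2 : Additivity F lam) {Y : I → PowerSeries R}
    (hY : ∀ k, PowerSeries.constantCoeff (Y k) = 0) (i j : I) :
    ∑ k, MvPowerSeries.subst Y (MvPowerSeries.pderiv K k (F i)) *
        ((if k = j then 1 else 0) + scale (fun n => lam n k j) (Y k)) =
      scale (fun n => lam (n + 1) i j) (MvPowerSeries.subst Y (F i)) := by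
  simp only [mul_add, Finset.sum_add_distrib]
  simp only [mul_ite, mul_one, mul_zero, Finset.sum_ite_eq', Finset.mem_univ, if_true]
  ext n
  have hN : n < n + 2 := by omega
  rw [map_add, coeff_sum_subst_pderiv_mul hY (F i) _ (by omega : n + 1 < n + 2), coeff_scale,
    coeff_subst_eq_aeval_truncTotal hY (F i) hN, coeff_subst_eq_sum hY _ hN,
    ← coeff_scale (fun n => lam (n + 1) i j)]
  set S := (Finsupp.finite_of_degree_lt (σ := I) (n + 2)).toFinset with hS
  have hq : MvPowerSeries.truncTotal (n + 2) (F i) =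
      ∑ p ∈ S, a F i p • MvPolynomial.monomial p (1 : K) := by
    rw [MvPowerSeries.truncTotal, MvPowerSeries.truncFinset_apply]
    refine Finset.sum_congr rfl fun p _ => ?_
    rw [MvPolynomial.smul_monomial, smul_eq_mul, mul_one]
    rfl
  have hmon : ∀ p : I →₀ ℕ, (p.prod fun k e => Y k ^ e) =
      MvPolynomial.aeval Y (MvPolynomial.monomial p (1 : K)) := by
    intro p
    rw [MvPolynomial.aeval_monomial, map_one, one_mul]
  rw [hq, map_sum, map_sum, map_sum]
  simp only [map_sum, map_smul, Derivation.map_smul, Finset.sum_mul, smul_mul_assoc,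
    PowerSeries.coeff_smul, hmon]
  rw [Finset.sum_comm, ← Finset.sum_add_distrib]
  refine Finset.sum_congr rfl fun p _ => ?_
  rw [← Finset.smul_sum, ← map_sum]
  have h3 : MvPowerSeries.coeff p (MvPowerSeries.pderiv K j (F i)) =
      (lam (p.degree + 1) i j - ∑ l, (p l : K) * a₁ F l j) * a F i p := by
    rw [MvPowerSeries.coeff_pderiv, ← h1.mul_eq]
    rfl
  rw [h3]
  by_cases hp : a F i p = 0
  · simp [hp]
  · rw [scale_monomial h2 hY i j hp, map_add, smul_add, PowerSeries.coeff_smul, smul_smul,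
      mul_comm]

end FunctionalEquation

section Linearization

variable {K I : Type*} [Field K]

theorem pderiv_comm (i j : I) (f : MvPowerSeries I K) :
    MvPowerSeries.pderiv K i (MvPowerSeries.pderiv K j f) =
      MvPowerSeries.pderiv K j (MvPowerSeries.pderiv K i f) := by
  ext n
  simp only [MvPowerSeries.coeff_pderiv]
  rw [add_right_comm]
  by_cases h : i = j
  · subst h; rfl
  · simp only [Finsupp.add_apply, Finsupp.single_eq_of_ne h, Finsupp.single_eq_of_ne (Ne.symm h)]
    ring_nf

theorem constantCoeff_pderiv (F : I → MvPowerSeries I K) (i j : I) :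
    MvPowerSeries.constantCoeff (MvPowerSeries.pderiv K j (F i)) = a₁ F i j := by
  rw [← MvPowerSeries.coeff_zero_eq_constantCoeff_apply, MvPowerSeries.coeff_pderiv]
  simp [a₁, a]

variable [CharZero K] [Fintype I] [DecidableEq I] {R : Type*} [CommRing R] [Algebra K R]
  {F : I → MvPowerSeries I K} {lam : ℕ → I → I → K}

/-- The linearization of the functional equation in the direction of `h_d`. -/
theorem subst_functional_equation_linearized (h1 : CoeffRecursion F lam) (h2 : Additivity F lam)
    {Y : I → PowerSeries R} (hY : ∀ k, PowerSeries.constantCoeff (Y k) = 0) (i j d : I)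
    {V : PowerSeries R} (hV : PowerSeries.constantCoeff V = 0) :
    (∑ k, MvPowerSeries.subst Y (MvPowerSeries.pderiv K k (MvPowerSeries.pderiv K d (F i))) *
        ((if k = j then 1 else 0) + scale (fun n => lam n k j) (Y k))) * V +
      MvPowerSeries.subst Y (MvPowerSeries.pderiv K d (F i)) * scale (fun n => lam n d j) V =
      scale (fun n => lam (n + 1) i j)
        (MvPowerSeries.subst Y (MvPowerSeries.pderiv K d (F i)) * V) := by
  -- the equation is differentiated at `s = 0` along the path `Y + s V e_d`
  let ι : R →ₐ[K] Polynomial R := Polynomial.CAlgHom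
  let ε : Polynomial R →ₐ[K] R := (Polynomial.aeval (0 : R)).restrictScalars K
  let D : Derivation K (Polynomial R) (Polynomial R) :=
    (Polynomial.derivative' (R := R)).restrictScalars K
  let V' : PowerSeries (Polynomial R) := PowerSeries.map (ι : R →+* Polynomial R) V
  let Y' : I → PowerSeries (Polynomial R) := fun k =>
    PowerSeries.map (ι : R →+* Polynomial R) (Y k) +
      if k = d then PowerSeries.C Polynomial.X * V' else 0
  have hY' : ∀ k, PowerSeries.constantCoeff (Y' k) = 0 := by
    intro k
    have hm : ∀ W : PowerSeries R, PowerSeries.constantCoeff W = 0 →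
        PowerSeries.constantCoeff (PowerSeries.map (ι : R →+* Polynomial R) W) = 0 := by
      intro W hW
      rw [← PowerSeries.coeff_zero_eq_constantCoeff_apply, PowerSeries.coeff_map,
        PowerSeries.coeff_zero_eq_constantCoeff_apply, hW, map_zero]
    simp only [Y', map_add, hm _ (hY k), zero_add]
    split_ifs
    · rw [map_mul, hm _ hV, mul_zero]
    · simp
  have hDι : ∀ W : PowerSeries R,
      mapDerivation D (PowerSeries.map (ι : R →+* Polynomial R) W) = 0 := by
    intro W
    ext n : 1
    rw [coeff_mapDerivation, PowerSeries.coeff_map]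
    exact Polynomial.derivative_C
  have hDX : mapDerivation D (PowerSeries.C (Polynomial.X : Polynomial R)) = 1 := by
    ext n : 1
    rw [coeff_mapDerivation, PowerSeries.coeff_C, PowerSeries.coeff_one]
    split_ifs
    · exact Polynomial.derivative_X
    · simp
  have hDY : ∀ k, mapDerivation D (Y' k) = if k = d then V' else 0 := by
    intro k
    simp only [Y', map_add, hDι, zero_add]
    split_ifs
    · rw [Derivation.leibniz, hDX, hDι, smul_zero, zero_add, smul_eq_mul, mul_one]
    · simp
  have hει : ∀ W : PowerSeries R, PowerSeries.map (ε : Polynomial R →+* R)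
      (PowerSeries.map (ι : R →+* Polynomial R) W) = W := by
    intro W
    ext n
    simp [ι, ε]
  have hεY : ∀ k, PowerSeries.map (ε : Polynomial R →+* R) (Y' k) = Y k := by
    intro k
    simp only [Y', map_add, hει]
    split_ifs
    · simp [ε]
    · simp
  have hone : ∀ b : Prop, [Decidable b] →
      mapDerivation D (if b then 1 else 0 : PowerSeries (Polynomial R)) = 0 := by
    intro b _
    split_ifs <;> simp
  have key := congrArg (mapDerivation D) (subst_functional_equation h1 h2 hY' i j)
  simp only [map_sum, Derivation.leibniz, mapDerivation_scale, map_add, hone, hDY,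
    mapDerivation_subst hY', smul_eq_mul, zero_add, mul_ite, mul_zero, Finset.sum_ite_eq',
    Finset.mem_univ, if_true, apply_ite (scale _), map_zero, Finset.sum_add_distrib] at key
  have key2 := congrArg (PowerSeries.map (ε : Polynomial R →+* R)) key
  have hS : ∀ G : MvPowerSeries I K,
      PowerSeries.map (ε : Polynomial R →+* R) (MvPowerSeries.subst Y' G) =
        MvPowerSeries.subst Y G := by
    intro G
    rw [map_subst_algHom hY']
    simp only [hεY]
  have hone' : ∀ b : Prop, [Decidable b] →
      PowerSeries.map (ε : Polynomial R →+* R) (if b then 1 else 0 : PowerSeries (Polynomial R)) =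
        if b then 1 else 0 := by
    intro b _
    split_ifs <;> simp
  simp only [map_add, map_sum, map_mul, map_scale, hS, hεY, hone', V', hει] at key2
  rw [← key2, add_comm, Finset.sum_mul]
  congr 1
  refine Finset.sum_congr rfl fun k _ => ?_
  rw [pderiv_comm]
  ring

end Linearization

/-! ### The transfer series -/

section Transfer

variable {K I : Type*} [Field K]

/-- When `d i` is chosen such that `a₁ F i (d i) ≠ 0`, the substitution of `X` in the series
`transfer F d n i` is the left factor of `X_i(n + 1)` in the coproduct of `X_i`. -/
noncomputable def transfer (F : I → MvPowerSeries I K) (d : I → I) :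
    ℕ → I → MvPowerSeries I K
  | 0 => F
  | n + 1 => fun i =>
      (a₁ F i (d i))⁻¹ • (MvPowerSeries.pderiv K (d i) (F i) * transfer F d n (d i))

theorem constantCoeff_transfer {F : I → MvPowerSeries I K}
    (hF : ∀ i, MvPowerSeries.constantCoeff (F i) = 1) {d : I → I}
    (hd : ∀ i, a₁ F i (d i) ≠ 0) (n : ℕ) (i : I) :
    MvPowerSeries.constantCoeff (transfer F d n i) = 1 := by
  induction n generalizing i with
  | zero => exact hF i
  | succ n ih =>
    rw [transfer, ← MvPowerSeries.coeff_zero_eq_constantCoeff_apply, MvPowerSeries.coeff_smul,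
      MvPowerSeries.coeff_zero_eq_constantCoeff_apply, map_mul, ih, constantCoeff_pderiv, mul_one,
      inv_mul_cancel₀ (hd i)]

variable [CharZero K] [Fintype I] [DecidableEq I] {R : Type*} [CommRing R] [Algebra K R]
  {F : I → MvPowerSeries I K} {lam : ℕ → I → I → K}

/-- The transfer series satisfy the functional equation of the `F_i`, with a shift of `n`. -/
theorem subst_transfer_functional_equation (h1 : CoeffRecursion F lam) (h2 : Additivity F lam)
    {d : I → I} {Y : I → PowerSeries R}
    (hY : ∀ k, PowerSeries.constantCoeff (Y k) = 0) (n : ℕ) (i j : I) :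
    ∑ k, MvPowerSeries.subst Y (MvPowerSeries.pderiv K k (transfer F d n i)) *
        ((if k = j then 1 else 0) + scale (fun n => lam n k j) (Y k)) =
      scale (fun m => lam (m + (n + 1)) i j) (MvPowerSeries.subst Y (transfer F d n i)) := by
  have hs := hasSubst_of_forall hY
  induction n generalizing i with
  | zero => exact subst_functional_equation h1 h2 hY i j
  | succ n ih =>
    have h3 := subst_functional_equation_linearized h1 h2 hY i j (d i)
      (V := PowerSeries.X ^ (n + 1) * MvPowerSeries.subst Y (transfer F d n (d i))) (by simp)
    rw [scale_X_pow_mul, ← ih (d i), mul_left_comm _ (PowerSeries.X ^ (n + 1)),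
      mul_left_comm _ (PowerSeries.X ^ (n + 1)), mul_left_comm _ (PowerSeries.X ^ (n + 1)),
      scale_X_pow_mul, ← mul_add] at h3
    have hX : IsLeftRegular ((PowerSeries.X : PowerSeries R) ^ (n + 1)) := by
      intro f g hfg
      ext m
      have := congrArg (PowerSeries.coeff (m + (n + 1))) hfg
      simpa [PowerSeries.coeff_X_pow_mul] using this
    have h4 := hX h3
    simp only [transfer, Derivation.map_smul, Derivation.leibniz, smul_eq_mul,
      MvPowerSeries.subst_smul hs, MvPowerSeries.subst_add hs, MvPowerSeries.subst_mul hs,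
      smul_mul_assoc, map_smul]
    rw [← Finset.smul_sum]
    congr 1
    simp only [← add_assoc] at h4 ⊢
    rw [← h4, Finset.sum_mul, Finset.mul_sum, ← Finset.sum_add_distrib]
    refine Finset.sum_congr rfl fun k _ => ?_
    ring

end Transfer

/-! ### A universal identity -/

section Twist

variable {R : Type*} [CommRing R]

/-- The series `∑ₙ zⁿ Qₙ vₙ`. -/
noncomputable def twist (Q : ℕ → PowerSeries R) (v : ℕ → R) : PowerSeries R :=
  PowerSeries.mk fun N =>
    ∑ c ∈ Finset.HasAntidiagonal.antidiagonal N, PowerSeries.coeff c.1 (Q c.2) * v c.2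

theorem coeff_twist (Q : ℕ → PowerSeries R) (v : ℕ → R) {N M : ℕ} (h : N < M) :
    PowerSeries.coeff N (twist Q v) = PowerSeries.coeff N
      (∑ n ∈ Finset.range M, PowerSeries.X ^ n * (Q n * PowerSeries.C (v n))) := by
  have h0 : ∀ n, PowerSeries.coeff N (PowerSeries.X ^ n * (Q n * PowerSeries.C (v n))) =
      if n ≤ N then PowerSeries.coeff (N - n) (Q n) * v n else 0 := by
    intro n
    rw [PowerSeries.coeff_X_pow_mul']
    simp only [PowerSeries.coeff_mul_C]
  rw [map_sum, twist, PowerSeries.coeff_mk]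
  simp only [h0]
  rw [← Finset.sum_filter, ← Finset.Nat.sum_antidiagonal_swap]
  rw [Finset.Nat.sum_antidiagonal_eq_sum_range_succ_mk]
  refine Finset.sum_congr ?_ fun _ _ => rfl
  ext n
  simp only [Finset.mem_range, Finset.mem_filter]
  omega

theorem map_twist {S : Type*} [CommRing S] (φ : R →+* S) (Q : ℕ → PowerSeries R) (v : ℕ → R) :
    PowerSeries.map φ (twist Q v) = twist (fun n => PowerSeries.map φ (Q n)) fun n => φ (v n) := by
  ext N
  simp [twist, map_sum]

theorem twist_one (v : ℕ → R) : twist (fun _ => 1) v = PowerSeries.mk v := by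
  ext N
  rw [twist, PowerSeries.coeff_mk, PowerSeries.coeff_mk, Finset.sum_eq_single (0, N)]
  · simp
  · rintro ⟨m, n⟩ hmn hne
    have hm : m ≠ 0 := by
      rintro rfl
      simp only [Finset.HasAntidiagonal.mem_antidiagonal, zero_add] at hmn
      exact hne (by rw [hmn])
    simp [PowerSeries.coeff_one, hm]
  · simp

variable {K : Type*} [Field K] [Algebra K R]

/-- If each `Qₙ` satisfies a differential equation whose scalars are shifted by `n`, then the shifts
combine with the powers of `z`, so that `∑ₙ zⁿ Qₙ vₙ` satisfies the unshifted equation. -/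
theorem mapDerivation_twist (D : Derivation K R R) (Q : ℕ → PowerSeries R) (v : ℕ → R)
    (c : ℕ → K) (m : ℕ) (hv : ∀ n, D (v n) = 0)
    (hQ : ∀ n, mapDerivation D (Q n) = PowerSeries.X ^ m * scale (fun k => c (k + n)) (Q n)) :
    mapDerivation D (twist Q v) = PowerSeries.X ^ m * scale c (twist Q v) := by
  have hC : ∀ n, mapDerivation D (PowerSeries.C (v n)) = 0 := by
    intro n
    ext k
    rw [coeff_mapDerivation, PowerSeries.coeff_C]
    split_ifs
    · simp [hv]
    · simp
  have hsC : ∀ (e : ℕ → K) (f : PowerSeries R) (r : R),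
      scale e (f * PowerSeries.C r) = scale e f * PowerSeries.C r := by
    intro e f r
    ext k
    simp
  have key : ∀ M, mapDerivation D
      (∑ n ∈ Finset.range M, PowerSeries.X ^ n * (Q n * PowerSeries.C (v n))) =
      PowerSeries.X ^ m * scale c
        (∑ n ∈ Finset.range M, PowerSeries.X ^ n * (Q n * PowerSeries.C (v n))) := by
    intro M
    rw [map_sum, map_sum, Finset.mul_sum]
    refine Finset.sum_congr rfl fun n _ => ?_
    rw [Derivation.leibniz, Derivation.leibniz, mapDerivation_X_pow, hC, hQ, scale_X_pow_mul, hsC]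
    simp only [smul_eq_mul]
    ring
  ext N
  rw [coeff_mapDerivation, coeff_twist Q v N.lt_succ_self, ← coeff_mapDerivation, key,
    PowerSeries.coeff_X_pow_mul', PowerSeries.coeff_X_pow_mul']
  split_ifs
  · rw [coeff_scale, coeff_scale, coeff_twist Q v (by omega : N - m < N.succ)]
  · rfl

end Twist

section Generic

variable {K I B : Type*} [Field K] [CommRing B] [Algebra K B]

/-- The generic series without constant term. -/
noncomputable def genericSeries (B : Type*) [CommRing B] {I : Type*} (l : I) :
    PowerSeries (MvPolynomial (I × ℕ) B) :=
  PowerSeries.mk fun n => Nat.casesOn n 0 fun k => MvPolynomial.X (l, k)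

theorem constantCoeff_genericSeries (l : I) :
    PowerSeries.constantCoeff (genericSeries B l) = 0 := by
  rw [← PowerSeries.coeff_zero_eq_constantCoeff_apply, genericSeries, PowerSeries.coeff_mk]
  rfl

variable [DecidableEq I] (lam : ℕ → I → I → K)

/-- The derivation which sends the generic series `U_l` to
`z^{m+1} (δ_{lj} + ∑ₙ λ_n^{(l,j)} U_l(n) zⁿ)`. -/
noncomputable def genericDerivation (B : Type*) [CommRing B] [Algebra K B] (j : I) (m : ℕ) :
    Derivation K (MvPolynomial (I × ℕ) B) (MvPolynomial (I × ℕ) B) :=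
  (MvPolynomial.mkDerivation B fun v => PowerSeries.coeff (v.2 + 1) (PowerSeries.X ^ (m + 1) *
    ((if v.1 = j then 1 else 0) +
      scale (fun n => lam n v.1 j) (genericSeries B v.1)))).restrictScalars K

theorem genericDerivation_X (j : I) (m : ℕ) (v : I × ℕ) :
    genericDerivation lam B j m (MvPolynomial.X v) =
      PowerSeries.coeff (v.2 + 1) (PowerSeries.X ^ (m + 1) *
        ((if v.1 = j then 1 else 0) + scale (fun n => lam n v.1 j) (genericSeries B v.1))) := by
  rw [genericDerivation, Derivation.restrictScalars_apply, MvPolynomial.mkDerivation_X]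

theorem genericDerivation_C (j : I) (m : ℕ) (b : B) :
    genericDerivation lam B j m (MvPolynomial.C b) = 0 := by
  rw [genericDerivation, Derivation.restrictScalars_apply, MvPolynomial.derivation_C]

theorem mapDerivation_genericSeries (j : I) (m : ℕ) (l : I) :
    mapDerivation (genericDerivation lam B j m) (genericSeries B l) = PowerSeries.X ^ (m + 1) *
      ((if l = j then 1 else 0) + scale (fun n => lam n l j) (genericSeries B l)) := by
  ext n : 1
  rw [coeff_mapDerivation]
  rcases n with _ | k
  · rw [PowerSeries.coeff_X_pow_mul', if_neg (by omega), genericSeries, PowerSeries.coeff_mk]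
    exact map_zero _
  · rw [genericSeries, PowerSeries.coeff_mk]
    exact genericDerivation_X lam j m (l, k)

variable [CharZero K]

theorem notMem_vars_of_pderiv_eq_zero (K : Type*) {B σ : Type*} [Field K] [CharZero K]
    [CommRing B] [Algebra K B] (g : MvPolynomial σ B) (v : σ) (h : MvPolynomial.pderiv v g = 0) :
    v ∉ g.vars := by
  intro hv
  obtain ⟨s, hs, hvs⟩ := (MvPolynomial.mem_vars_iff_mem_support v).mp hv
  have hsv : s v ≠ 0 := Finsupp.mem_support_iff.mp hvs
  have h2 := congrArg (MvPolynomial.coeff (s - Finsupp.single v 1)) h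
  have hle : Finsupp.single v 1 ≤ s := by
    rw [Finsupp.single_le_iff]
    omega
  rw [MvPolynomial.coeff_pderiv, tsub_add_cancel_of_le hle, MvPolynomial.coeff_zero] at h2
  have h3 : ((s - Finsupp.single v 1 : σ →₀ ℕ) v + 1 : ℕ) = s v := by
    simp only [Finsupp.tsub_apply, Finsupp.single_eq_same]
    omega
  have h4 : ((s v : K)) • MvPolynomial.coeff s g = 0 := by
    rw [Algebra.smul_def, map_natCast, ← h3, mul_comm]
    exact_mod_cast h2
  rw [smul_eq_zero_iff_right (by exact_mod_cast hsv)] at h4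
  exact MvPolynomial.mem_support_iff.mp hs h4

/-- A polynomial which is killed by all the generic derivations is constant. -/
theorem eq_C_of_genericDerivation_eq_zero (g : MvPolynomial (I × ℕ) B)
    (h : ∀ j m, genericDerivation lam B j m g = 0) : g = MvPolynomial.C (g.coeff 0) := by
  rw [← MvPolynomial.vars_eq_empty_iff_eq_C]
  by_contra hne
  obtain ⟨⟨j, m⟩, hv, hmax⟩ := Finset.exists_max_image g.vars Prod.snd
    (Finset.nonempty_iff_ne_empty.mpr hne)
  -- no variable of degree larger than `m` occurs, so that `g` only sees the leading part of the
  -- derivation, which is a partial derivative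
  have h2 : MvPolynomial.pderiv (j, m) g = (MvPolynomial.mkDerivation B fun v : I × ℕ =>
      PowerSeries.coeff (v.2 + 1) (PowerSeries.X ^ (m + 1) * ((if v.1 = j then 1 else 0) +
        scale (fun n => lam n v.1 j) (genericSeries B v.1)))) g := by
    refine MvPolynomial.derivation_eq_of_forall_mem_vars fun v hvg => ?_
    obtain ⟨l, k⟩ := v
    have hk : k ≤ m := hmax _ hvg
    rw [MvPolynomial.mkDerivation_X, MvPolynomial.pderiv_X, PowerSeries.coeff_X_pow_mul']
    dsimp only
    rcases hk.lt_or_eq with hk | rfl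
    · rw [if_neg (by omega), Pi.single_eq_of_ne]
      rintro ⟨⟩
      omega
    · rw [if_pos le_rfl, Nat.sub_self, map_add, coeff_scale,
        PowerSeries.coeff_zero_eq_constantCoeff_apply,
        PowerSeries.coeff_zero_eq_constantCoeff_apply, constantCoeff_genericSeries, smul_zero,
        add_zero]
      by_cases hl : l = j
      · subst hl; simp
      · rw [if_neg hl, Pi.single_eq_of_ne (by rintro ⟨⟩; exact hl rfl), map_zero]
  have h3 := h j m
  rw [genericDerivation, Derivation.restrictScalars_apply, ← h2] at h3
  exact notMem_vars_of_pderiv_eq_zero K g _ h3 hv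

/-- A system of differential equations determines a series from its value at `0`. -/
theorem eq_zero_of_mapDerivation_genericDerivation (c : I → ℕ → K)
    (G : PowerSeries (MvPolynomial (I × ℕ) B))
    (h : ∀ j m, mapDerivation (genericDerivation lam B j m) G =
      PowerSeries.X ^ (m + 1) * scale (c j) G)
    (h0 : PowerSeries.map (MvPolynomial.constantCoeff (R := B) (σ := I × ℕ)) G = 0) : G = 0 := by
  ext N : 1
  rw [map_zero]
  induction N using Nat.strong_induction_on with
  | _ N ih =>
    have h1 := eq_C_of_genericDerivation_eq_zero lam (PowerSeries.coeff N G) fun j m => by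
      rw [← coeff_mapDerivation, h, PowerSeries.coeff_X_pow_mul']
      split_ifs
      · rw [coeff_scale, ih (N - (m + 1)) (by omega), smul_zero]
      · rfl
    have h2 := congrArg (PowerSeries.coeff N) h0
    rw [PowerSeries.coeff_map, map_zero] at h2
    rw [h1, ← MvPolynomial.constantCoeff_eq, h2, map_zero]

variable [Fintype I] {F : I → MvPowerSeries I K} {lam}

/-- The identity `F_i(U + z T) = twist …` for a generic series `U`: both sides satisfy the
differential equations of `eq_zero_of_mapDerivation_genericDerivation`, and they agree at `U = 0`,
where every transfer series is equal to `1`. -/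
theorem subst_generic_add_twist (hF : ∀ i, MvPowerSeries.constantCoeff (F i) = 1)
    (h1 : CoeffRecursion F lam) (h2 : Additivity F lam) {d : I → I}
    (hd : ∀ i, a₁ F i (d i) ≠ 0) (V : I → PowerSeries B)
    (hV : ∀ k, PowerSeries.constantCoeff (V k) = 0) (i : I) :
    MvPowerSeries.subst (fun k => genericSeries B k + PowerSeries.X *
        twist (fun n => MvPowerSeries.subst (genericSeries B) (transfer F d n k))
          fun n => MvPolynomial.C (PowerSeries.coeff (n + 1) (V k))) (F i) =
      twist (fun n => MvPowerSeries.subst (genericSeries B) (transfer F d n i))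
        fun n => MvPolynomial.C (PowerSeries.coeff n (MvPowerSeries.subst V (F i) :
          PowerSeries B)) := by
  have hU : ∀ k : I, PowerSeries.constantCoeff (genericSeries B k) = 0 :=
    constantCoeff_genericSeries
  set T : I → (ℕ → B) → PowerSeries (MvPolynomial (I × ℕ) B) := fun k v =>
    twist (fun n => MvPowerSeries.subst (genericSeries B) (transfer F d n k))
      fun n => MvPolynomial.C (v n) with hT
  set Y : I → PowerSeries (MvPolynomial (I × ℕ) B) := fun k => genericSeries B k +
    PowerSeries.X * T k fun n => PowerSeries.coeff (n + 1) (V k) with hYdef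
  have hY : ∀ k, PowerSeries.constantCoeff (Y k) = 0 := fun k => by simp [Y, hU]
  have hDT : ∀ j m k v, mapDerivation (genericDerivation lam B j m) (T k v) =
      PowerSeries.X ^ (m + 1) * scale (fun n => lam (n + 1) k j) (T k v) := by
    intro j m k v
    refine mapDerivation_twist _ _ _ (fun n => lam (n + 1) k j) _
      (fun n => genericDerivation_C lam j m _) fun n => ?_
    simp only [add_assoc]
    rw [← subst_transfer_functional_equation h1 h2 hU, mapDerivation_subst hU, Finset.mul_sum]
    refine Finset.sum_congr rfl fun l _ => ?_
    rw [mapDerivation_genericSeries]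
    ring
  have hDY : ∀ j m k, mapDerivation (genericDerivation lam B j m) (Y k) =
      PowerSeries.X ^ (m + 1) *
        ((if k = j then 1 else 0) + scale (fun n => lam n k j) (Y k)) := by
    intro j m k
    have hX := scale_X_pow_mul (fun n => lam n k j)
      (T k fun n => PowerSeries.coeff (n + 1) (V k)) 1
    have hX' := mapDerivation_X_pow (genericDerivation lam B j m) 1
    rw [pow_one] at hX hX'
    rw [hYdef]
    simp only [map_add, Derivation.leibniz, hDT, hX, hX', mapDerivation_genericSeries, smul_eq_mul]
    ring
  have hDS : ∀ j m, mapDerivation (genericDerivation lam B j m) (MvPowerSeries.subst Y (F i)) =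
      PowerSeries.X ^ (m + 1) *
        scale (fun n => lam (n + 1) i j) (MvPowerSeries.subst Y (F i)) := by
    intro j m
    rw [mapDerivation_subst hY, ← subst_functional_equation h1 h2 hY, Finset.mul_sum]
    refine Finset.sum_congr rfl fun l _ => ?_
    rw [hDY]
    ring
  rw [← sub_eq_zero]
  refine eq_zero_of_mapDerivation_genericDerivation lam (fun j n => lam (n + 1) i j) _
    (fun j m => ?_) ?_
  · rw [map_sub, hDT, hDS, map_sub, mul_sub]
  · let φ : MvPolynomial (I × ℕ) B →ₐ[K] B :=
      (MvPolynomial.aeval fun _ => (0 : B)).restrictScalars K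
    have hφ : (MvPolynomial.constantCoeff (R := B) (σ := I × ℕ)) =
        (φ : MvPolynomial (I × ℕ) B →+* B) := by
      ext v <;> simp [φ]
    have hφU : ∀ k, PowerSeries.map (φ : MvPolynomial (I × ℕ) B →+* B) (genericSeries B k) = 0 := by
      intro k
      ext n
      rw [PowerSeries.coeff_map, genericSeries, PowerSeries.coeff_mk]
      rcases n with _ | n <;> simp [φ]
    have hφS : ∀ n k, PowerSeries.map (φ : MvPolynomial (I × ℕ) B →+* B)
        (MvPowerSeries.subst (genericSeries B) (transfer F d n k)) = 1 := by
      intro n k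
      rw [map_subst_algHom hU]
      simp only [hφU]
      have h0 : ∀ l : I, PowerSeries.constantCoeff ((fun _ => 0 : I → PowerSeries B) l) = 0 := by
        simp
      ext N
      rw [coeff_subst_eq_sum h0 _ N.lt_succ_self, Finset.sum_eq_single 0]
      · rw [MvPowerSeries.coeff_zero_eq_constantCoeff_apply, constantCoeff_transfer hF hd]
        simp
      · intro p _ hp
        obtain ⟨l, hl⟩ := Finsupp.ne_iff.mp hp
        rw [Finsupp.prod, Finset.prod_eq_zero (Finsupp.mem_support_iff.mpr hl) (zero_pow hl)]
        simp
      · simp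
    have hφC : ∀ b : B, (φ : MvPolynomial (I × ℕ) B →+* B) (MvPolynomial.C b) = b := by
      intro b
      simp [φ]
    have hφT : ∀ k v, PowerSeries.map (φ : MvPolynomial (I × ℕ) B →+* B) (T k v) =
        PowerSeries.mk v := by
      intro k v
      rw [hT]
      simp only [map_twist, hφS, hφC, twist_one]
    have hφY : ∀ k, PowerSeries.map (φ : MvPolynomial (I × ℕ) B →+* B) (Y k) = V k := by
      intro k
      rw [hYdef]
      simp only [map_add, map_mul, hφU, hφT, PowerSeries.map_X, zero_add]
      ext n
      rcases n with _ | n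
      · simp [hV]
      · rw [PowerSeries.coeff_succ_X_mul, PowerSeries.coeff_mk]
    rw [hφ, map_sub, map_subst_algHom hY, hφT]
    simp only [hφY]
    rw [sub_eq_zero]
    ext n
    rw [PowerSeries.coeff_mk]

/-- Two substitutions in the `F_i` combine through the transfer series. -/
theorem subst_add_twist {T : Type*} [CommRing T] [Algebra K T]
    (hF : ∀ i, MvPowerSeries.constantCoeff (F i) = 1)
    (h1 : CoeffRecursion F lam) (h2 : Additivity F lam) {d : I → I}
    (hd : ∀ i, a₁ F i (d i) ≠ 0) (g : B →ₐ[K] T) (Z : I → PowerSeries T)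
    (hZ : ∀ k, PowerSeries.constantCoeff (Z k) = 0) (V : I → PowerSeries B)
    (hV : ∀ k, PowerSeries.constantCoeff (V k) = 0) (i : I) :
    MvPowerSeries.subst (fun k => Z k + PowerSeries.X *
        twist (fun n => MvPowerSeries.subst Z (transfer F d n k))
          fun n => g (PowerSeries.coeff (n + 1) (V k))) (F i) =
      twist (fun n => MvPowerSeries.subst Z (transfer F d n i))
        fun n => g (PowerSeries.coeff n (MvPowerSeries.subst V (F i) : PowerSeries B)) := by
  have hU : ∀ k : I, PowerSeries.constantCoeff (genericSeries B k) = 0 :=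
    constantCoeff_genericSeries
  let φ : MvPolynomial (I × ℕ) B →ₐ[K] T :=
    MvPolynomial.aevalTower g fun v => PowerSeries.coeff (v.2 + 1) (Z v.1)
  have hφU : ∀ k, PowerSeries.map (φ : MvPolynomial (I × ℕ) B →+* T) (genericSeries B k) = Z k := by
    intro k
    ext n
    rw [PowerSeries.coeff_map, genericSeries, PowerSeries.coeff_mk]
    rcases n with _ | n
    · simp [hZ]
    · simp [φ]
  have hφC : ∀ b : B, (φ : MvPolynomial (I × ℕ) B →+* T) (MvPolynomial.C b) = g b := by
    intro b
    simp [φ]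
  have key := congrArg (PowerSeries.map (φ : MvPolynomial (I × ℕ) B →+* T))
    (subst_generic_add_twist hF h1 h2 hd V hV i)
  rw [map_subst_algHom (fun k => by simp [hU])] at key
  simp only [map_add, map_mul, PowerSeries.map_X, map_twist, map_subst_algHom hU, hφU, hφC] at key
  exact key

end Generic

/-! ### Trees and forests -/

namespace PTree

variable {D : Type*}

theorem induction {p : PTree D → Prop} (h : ∀ d l, (∀ s ∈ l, p s) → p (node d l)) (t : PTree D) :
    p t := by
  refine PTree.rec (motive_1 := p) (motive_2 := fun l => ∀ s ∈ l, p s) h ?_ ?_ t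
  · simp
  · intro s l hs hl s' hs'
    rcases List.mem_cons.mp hs' with rfl | hs'
    · exact hs
    · exact hl _ hs'

theorem weight_le_weightList {s : PTree D} {l : List (PTree D)} (h : s ∈ l) :
    weight s ≤ weightList l := by
  rw [weightList_eq]
  exact List.single_le_sum (by simp) _ (List.mem_map_of_mem h)

theorem weight_pos (t : PTree D) : 0 < weight t := by
  cases t
  simp [weight]

end PTree

namespace RTree

variable {D : Type*}

/-- The decoration of the root. -/
def root : RTree D → D :=
  Quot.lift (fun t => match t with | .node d _ => d) fun _ _ h => by cases h <;> rfl

/-- The multiset of the branches at the root. -/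
def branches : RTree D → Multiset (RTree D) :=
  Quot.lift (fun t => match t with | .node _ l => (l.map mk : List (RTree D)))
    fun _ _ h => by
      cases h with
      | perm d h => exact Multiset.coe_eq_coe.mpr (h.map mk)
      | child d l₁ l₂ h =>
        have : mk _ = mk _ := Quot.sound h
        simp [this]

@[simp]
theorem root_mk_node (d : D) (l : List (PTree D)) : root (mk (.node d l)) = d := rfl

@[simp]
theorem branches_mk_node (d : D) (l : List (PTree D)) :
    branches (mk (.node d l)) = (l.map mk : List (RTree D)) := rfl

theorem exists_mk_eq (t : RTree D) : ∃ s : PTree D, mk s = t := ⟨t.out, mk_out t⟩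

@[simp]
theorem weight_mk (t : PTree D) : weight (mk t) = t.weight := rfl

theorem exists_graft_eq (t : RTree D) : ∃ l : List (PTree D), t = mk (.node t.root l) := by
  obtain ⟨⟨d, l⟩, rfl⟩ := exists_mk_eq t
  exact ⟨l, rfl⟩

@[simp]
theorem root_graft (d : D) (f : Multiset (RTree D)) : root (graft d f) = d := by
  induction f using Quotient.inductionOn
  rfl

@[simp]
theorem branches_graft (d : D) (f : Multiset (RTree D)) : branches (graft d f) = f := by
  induction f using Quotient.inductionOn with
  | _ l =>
    have h := branches_mk_node d (l.map out)
    simp only [List.map_map, Function.comp_def, mk_out, List.map_id'] at h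
    exact h

end RTree

section Forests

variable (K : Type*) {D : Type*} [Field K]

@[simp]
theorem ofForest_nil : ofForest K ([] : List (PTree D)) = 1 := rfl

@[simp]
theorem ofForest_cons (s : PTree D) (l : List (PTree D)) :
    ofForest K (s :: l) = ofPTree K s * ofForest K l := by
  simp [ofForest]

theorem toMultiset_injective {σ : Type*} :
    Function.Injective (Finsupp.toMultiset : (σ →₀ ℕ) →+ Multiset σ) := by
  classical
  exact Function.LeftInverse.injective Finsupp.toMultiset_toFinsupp

theorem exists_monomial_eq_ofForest (f : RTree D →₀ ℕ) :
    ∃ l : List (PTree D), MvPolynomial.monomial f 1 = ofForest K l := by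
  refine ⟨(Finsupp.toMultiset f).toList.map RTree.out, ?_⟩
  obtain ⟨f', h1, h2⟩ := exists_ofForest_eq K ((Finsupp.toMultiset f).toList.map RTree.out)
  rw [h2, MvPolynomial.coe_basisMonomials]
  have hf : f = f' := by
    apply toMultiset_injective
    rw [h1]
    simp [Function.comp_def, RTree.mk_out]
  rw [hf]

variable {K} in
theorem forest_induction {p : TreeAlgebra K D → Prop} (h0 : p 0)
    (hadd : ∀ x y, p x → p y → p (x + y)) (hsmul : ∀ (r : K) x, p x → p (r • x))
    (hf : ∀ l, p (ofForest K l)) (x : TreeAlgebra K D) : p x := by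
  rw [x.as_sum]
  refine Finset.sum_induction _ p hadd h0 fun f _ => ?_
  obtain ⟨l, hl⟩ := exists_monomial_eq_ofForest K f
  rw [← mul_one (MvPolynomial.coeff f x), ← smul_eq_mul, ← MvPolynomial.smul_monomial, hl]
  exact hsmul _ _ (hf l)

variable {K} in
/-- Two morphisms which agree on a tree as soon as they agree on its branches are equal. -/
theorem algHom_ext_node {A : Type*} [CommSemiring A] [Algebra K A] {φ ψ : TreeAlgebra K D →ₐ[K] A}
    (h : ∀ d l, φ (ofForest K l) = ψ (ofForest K l) →
      φ (ofPTree K (.node d l)) = ψ (ofPTree K (.node d l))) : φ = ψ := by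
  refine MvPolynomial.algHom_ext fun t => ?_
  obtain ⟨s, rfl⟩ := RTree.exists_mk_eq t
  change φ (ofPTree K s) = ψ (ofPTree K s)
  induction s using PTree.induction with
  | h d l ih =>
    refine h d l ?_
    rw [ofForest, map_list_prod, map_list_prod, List.map_map, List.map_map]
    exact congrArg List.prod (List.map_congr_left ih)

theorem constantCoeff_ofPTree (t : PTree D) : MvPolynomial.constantCoeff (ofPTree K t) = 0 := by
  simp [ofPTree]

theorem constantCoeff_Bplus (d : D) (x : TreeAlgebra K D) :
    MvPolynomial.constantCoeff (Bplus K d x) = 0 := by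
  induction x using forest_induction with
  | h0 => simp
  | hadd x y hx hy => simp [hx, hy]
  | hsmul r x hx => rw [map_smul, MvPolynomial.smul_eq_C_mul, map_mul, hx, mul_zero]
  | hf l => rw [Bplus_ofForest, constantCoeff_ofPTree]

theorem Bplus_monomial (d : D) (f : RTree D →₀ ℕ) :
    Bplus K d (MvPolynomial.monomial f 1) =
      MvPolynomial.X (RTree.graft d (Finsupp.toMultiset f)) := by
  have := (MvPolynomial.basisMonomials (RTree D) K).constr_basis K (fun f =>
    (MvPolynomial.X (RTree.graft d (Finsupp.toMultiset f)) : TreeAlgebra K D)) f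
  rwa [MvPolynomial.coe_basisMonomials] at this

theorem coeff_single_mul {σ : Type*} (t : σ) (x y : MvPolynomial σ K) :
    MvPolynomial.coeff (Finsupp.single t 1) (x * y) =
      MvPolynomial.constantCoeff x * MvPolynomial.coeff (Finsupp.single t 1) y +
        MvPolynomial.coeff (Finsupp.single t 1) x * MvPolynomial.constantCoeff y := by
  have h : ∀ z : MvPolynomial σ K, MvPolynomial.coeff (Finsupp.single t 1) z =
      MvPolynomial.constantCoeff (MvPolynomial.pderiv t z) := by
    intro z
    rw [MvPolynomial.constantCoeff_eq, MvPolynomial.coeff_pderiv]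
    simp
  rw [h, h, h, Derivation.leibniz]
  simp [mul_comm]

/-- The coefficient of a tree in `B⁺_d x` is the coefficient of the forest of its branches
in `x`. -/
theorem coeff_single_Bplus [DecidableEq D] (d : D) (x : TreeAlgebra K D) (t : RTree D)
    (f : RTree D →₀ ℕ) (hf : Finsupp.toMultiset f = t.branches) :
    MvPolynomial.coeff (Finsupp.single t 1) (Bplus K d x) =
      if t.root = d then MvPolynomial.coeff f x else 0 := by
  classical
  induction x using MvPolynomial.induction_on' with
  | add p q hp hq => rw [map_add, MvPolynomial.coeff_add, hp, hq]; split_ifs <;> simp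
  | monomial g c =>
    rw [← mul_one c, ← smul_eq_mul, ← MvPolynomial.smul_monomial, map_smul, Bplus_monomial,
      MvPolynomial.coeff_smul, MvPolynomial.coeff_smul, MvPolynomial.coeff_X,
      MvPolynomial.coeff_monomial]
    by_cases hd : t.root = d
    · rw [if_pos hd]
      congr 1
      refine if_congr ?_ rfl rfl
      rw [Finsupp.single_left_inj one_ne_zero]
      constructor
      · intro h
        apply toMultiset_injective
        rw [hf, ← h, RTree.branches_graft]
      · rintro rfl
        obtain ⟨l, hl⟩ := t.exists_graft_eq
        rw [hf, ← hd]
        conv_rhs => rw [hl]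
        conv_lhs => rw [hl]
        rw [RTree.root_mk_node, RTree.branches_mk_node, RTree.graft_coe]
    · rw [if_neg hd, if_neg, smul_zero]
      rw [Finsupp.single_left_inj one_ne_zero]
      rintro rfl
      exact hd (RTree.root_graft _ _)

theorem Bplus_injective (d : D) : Function.Injective (Bplus K d) := by
  classical
  refine (injective_iff_map_eq_zero _).mpr fun x hx => ?_
  ext f
  have h := coeff_single_Bplus K d x (RTree.graft d (Finsupp.toMultiset f)) f (by simp)
  rw [hx, RTree.root_graft, if_pos rfl] at h
  simpa using h.symm

/-- The coefficients of `B⁺_d x` at forests which are not trees vanish. -/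
theorem coeff_Bplus_eq_zero (d : D) (x : TreeAlgebra K D) (f : RTree D →₀ ℕ)
    (hf : ∀ t, f ≠ Finsupp.single t 1) : MvPolynomial.coeff f (Bplus K d x) = 0 := by
  classical
  induction x using MvPolynomial.induction_on' with
  | add p q hp hq => rw [map_add, MvPolynomial.coeff_add, hp, hq, add_zero]
  | monomial g c =>
    rw [← mul_one c, ← smul_eq_mul, ← MvPolynomial.smul_monomial, map_smul, Bplus_monomial,
      MvPolynomial.coeff_smul, MvPolynomial.coeff_X, if_neg (fun h => hf _ h.symm), smul_zero]

end Forests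

/-! ### The degree -/

section Degree

variable (K : Type*) {D : Type*} [Field K]

theorem isWeightedHomogeneous_ofPTree (t : PTree D) :
    MvPolynomial.IsWeightedHomogeneous RTree.weight (ofPTree K t) t.weight :=
  MvPolynomial.isWeightedHomogeneous_X K _ _

theorem isWeightedHomogeneous_ofForest (l : List (PTree D)) :
    MvPolynomial.IsWeightedHomogeneous RTree.weight (ofForest K l) (PTree.weightList l) := by
  induction l with
  | nil => exact MvPolynomial.isWeightedHomogeneous_one K _
  | cons s l ih =>
    rw [ofForest_cons, PTree.weightList]
    exact (isWeightedHomogeneous_ofPTree K s).mul ih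

variable {K} in
theorem homogeneous_induction {n : ℕ} (N : Submodule K (TreeAlgebra K D))
    (hN : ∀ l, PTree.weightList l = n → ofForest K l ∈ N) {x : TreeAlgebra K D}
    (hx : MvPolynomial.IsWeightedHomogeneous RTree.weight x n) : x ∈ N := by
  classical
  rw [x.as_sum]
  refine N.sum_mem fun f hf => ?_
  obtain ⟨l, hl⟩ := exists_monomial_eq_ofForest K f
  rw [← mul_one (MvPolynomial.coeff f x), ← smul_eq_mul, ← MvPolynomial.smul_monomial, hl]
  refine N.smul_mem _ (hN l ?_)
  rw [← hx (MvPolynomial.mem_support_iff.mp hf)]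
  refine (isWeightedHomogeneous_ofForest K l ?_).symm
  rw [← hl, MvPolynomial.coeff_monomial, if_pos rfl]
  exact one_ne_zero

theorem isWeightedHomogeneous_Bplus (d : D) {x : TreeAlgebra K D} {n : ℕ}
    (hx : MvPolynomial.IsWeightedHomogeneous RTree.weight x n) :
    MvPolynomial.IsWeightedHomogeneous RTree.weight (Bplus K d x) (n + 1) := by
  refine homogeneous_induction
    ((MvPolynomial.weightedHomogeneousSubmodule K RTree.weight (n + 1)).comap (Bplus K d)) ?_ hx
  intro l hl
  rw [Submodule.mem_comap, Bplus_ofForest, MvPolynomial.mem_weightedHomogeneousSubmodule]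
  have := isWeightedHomogeneous_ofPTree K (PTree.node d l)
  rwa [PTree.weight, hl] at this

end Degree

/-! ### The bialgebra of rooted trees -/

section Bialgebra

variable (K : Type*) {D : Type*} [Field K]

theorem comul_ofPTree (t : PTree D) : comul K (ofPTree K t) = comulPTree K t :=
  MvPolynomial.aeval_X _ _

theorem comul_ofForest (l : List (PTree D)) :
    comul K (ofForest K l) = (l.map (comulPTree K)).prod := by
  rw [ofForest, map_list_prod, List.map_map]
  exact congrArg List.prod (List.map_congr_left fun t _ => comul_ofPTree K t)

/-- The operators `B⁺_d` are cocycles. -/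
theorem comul_Bplus (d : D) (x : TreeAlgebra K D) :
    comul K (Bplus K d x) =
      Bplus K d x ⊗ₜ[K] 1 + (Bplus K d).lTensor (TreeAlgebra K D) (comul K x) := by
  induction x using forest_induction with
  | h0 => simp
  | hadd x y hx hy => simp only [map_add, hx, hy, TensorProduct.add_tmul]; abel
  | hsmul r x hx => simp only [map_smul, hx, smul_add, TensorProduct.smul_tmul']
  | hf l => rw [Bplus_ofForest, comul_ofPTree, comulPTree_node, comul_ofForest]

theorem map_left_lTensor {A : Type*} [Semiring A] [Algebra K A] (φ : TreeAlgebra K D →ₐ[K] A)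
    (d : D) (u : TreeAlgebra K D ⊗[K] TreeAlgebra K D) :
    Algebra.TensorProduct.map φ (AlgHom.id K (TreeAlgebra K D))
        ((Bplus K d).lTensor (TreeAlgebra K D) u) =
      (Bplus K d).lTensor A (Algebra.TensorProduct.map φ (AlgHom.id K (TreeAlgebra K D)) u) := by
  induction u using TensorProduct.induction_on with
  | zero => simp
  | tmul x y => simp
  | add u v hu hv => simp only [map_add, hu, hv]

theorem assoc_lTensor (d : D)
    (u : (TreeAlgebra K D ⊗[K] TreeAlgebra K D) ⊗[K] TreeAlgebra K D) :
    Algebra.TensorProduct.assoc K K K (TreeAlgebra K D) (TreeAlgebra K D) (TreeAlgebra K D)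
        ((Bplus K d).lTensor _ u) =
      ((Bplus K d).lTensor _).lTensor _ (Algebra.TensorProduct.assoc K K K (TreeAlgebra K D)
        (TreeAlgebra K D) (TreeAlgebra K D) u) := by
  induction u using TensorProduct.induction_on with
  | zero => simp
  | tmul x y =>
    induction x using TensorProduct.induction_on with
    | zero => simp
    | tmul x x' => simp
    | add u v hu hv => simp only [TensorProduct.add_tmul, map_add, hu, hv]
  | add u v hu hv => simp only [map_add, hu, hv]

theorem map_comul_lTensor (d : D) (u : TreeAlgebra K D ⊗[K] TreeAlgebra K D) :
    Algebra.TensorProduct.map (AlgHom.id K (TreeAlgebra K D)) (comul K)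
        ((Bplus K d).lTensor (TreeAlgebra K D) u) =
      Algebra.TensorProduct.assoc K K K (TreeAlgebra K D) (TreeAlgebra K D) (TreeAlgebra K D)
          ((Bplus K d).lTensor (TreeAlgebra K D) u ⊗ₜ[K] 1) +
        ((Bplus K d).lTensor _).lTensor _
          (Algebra.TensorProduct.map (AlgHom.id K (TreeAlgebra K D)) (comul K) u) := by
  induction u using TensorProduct.induction_on with
  | zero => simp
  | tmul x y => simp [comul_Bplus, TensorProduct.tmul_add]
  | add u v hu hv =>
    simp only [map_add, hu, hv, TensorProduct.add_tmul]
    abel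

theorem comul_coassoc :
    (Algebra.TensorProduct.assoc K K K (TreeAlgebra K D) (TreeAlgebra K D)
        (TreeAlgebra K D)).toAlgHom.comp
      ((Algebra.TensorProduct.map (comul K) (AlgHom.id K (TreeAlgebra K D))).comp (comul K)) =
      (Algebra.TensorProduct.map (AlgHom.id K (TreeAlgebra K D)) (comul K)).comp (comul K) := by
  refine algHom_ext_node
    (A := TreeAlgebra K D ⊗[K] (TreeAlgebra K D ⊗[K] TreeAlgebra K D)) fun d l h => ?_
  simp only [AlgHom.comp_apply, AlgEquiv.coe_toAlgHom] at h ⊢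
  rw [← Bplus_ofForest, comul_Bplus]
  simp only [map_add, map_left_lTensor, assoc_lTensor, map_comul_lTensor,
    Algebra.TensorProduct.map_tmul, h, comul_Bplus, map_one, TensorProduct.add_tmul,
    AlgHom.id_apply, Algebra.TensorProduct.assoc_tmul, Algebra.TensorProduct.one_def, add_assoc]

/-- The counit, which sends every nonempty forest to `0`. -/
noncomputable def counitHom : TreeAlgebra K D →ₐ[K] K := MvPolynomial.aeval fun _ => 0

theorem counitHom_apply (x : TreeAlgebra K D) :
    counitHom K x = MvPolynomial.constantCoeff x := by
  rw [counitHom, MvPolynomial.aeval_def]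
  simp [MvPolynomial.eval₂_zero'_apply]

theorem counit_left :
    (Algebra.TensorProduct.map (counitHom K) (AlgHom.id K (TreeAlgebra K D))).comp (comul K) =
      (Algebra.TensorProduct.lid K (TreeAlgebra K D)).symm := by
  refine algHom_ext_node fun d l h => ?_
  simp only [AlgHom.comp_apply] at h ⊢
  rw [← Bplus_ofForest, comul_Bplus, map_add, map_left_lTensor, h, Algebra.TensorProduct.map_tmul,
    counitHom_apply, constantCoeff_Bplus, TensorProduct.zero_tmul, zero_add]
  simp

theorem counit_right :
    (Algebra.TensorProduct.map (AlgHom.id K (TreeAlgebra K D)) (counitHom K)).comp (comul K) =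
      (Algebra.TensorProduct.rid K K (TreeAlgebra K D)).symm := by
  refine algHom_ext_node fun d l _ => ?_
  have h0 : ∀ u : TreeAlgebra K D ⊗[K] TreeAlgebra K D,
      Algebra.TensorProduct.map (AlgHom.id K (TreeAlgebra K D)) (counitHom K)
        ((Bplus K d).lTensor (TreeAlgebra K D) u) = 0 := by
    intro u
    induction u using TensorProduct.induction_on with
    | zero => simp
    | tmul x y => simp [counitHom_apply, constantCoeff_Bplus]
    | add u v hu hv => simp only [map_add, hu, hv, add_zero]
  simp only [AlgHom.comp_apply]
  rw [← Bplus_ofForest, comul_Bplus, map_add, h0, add_zero]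
  simp

/-- The Connes–Kreimer bialgebra structure. -/
noncomputable abbrev treeBialgebra : Bialgebra K (TreeAlgebra K D) :=
  Bialgebra.ofAlgHom (comul K) (counitHom K) (comul_coassoc K) (counit_left K) (counit_right K)

end Bialgebra

/-! ### The antipode -/

section Antipode

variable (K : Type*) {D : Type*} [Field K]

variable {K} in
/-- The convolution product of two algebra morphisms. -/
noncomputable def conv (φ ψ : TreeAlgebra K D →ₐ[K] TreeAlgebra K D) :
    TreeAlgebra K D →ₐ[K] TreeAlgebra K D :=
  ((Algebra.TensorProduct.lmul' K).comp (Algebra.TensorProduct.map φ ψ)).comp (comul K)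

/-- The tensors whose right factors have less than `n` vertices. -/
noncomputable def rightDegreeLT (D : Type*) (n : ℕ) :
    Submodule K (TreeAlgebra K D ⊗[K] TreeAlgebra K D) :=
  Submodule.span K {u | ∃ x l, PTree.weightList l < n ∧ u = x ⊗ₜ[K] ofForest K l}

theorem mul_mem_rightDegreeLT {u v : TreeAlgebra K D ⊗[K] TreeAlgebra K D} {m n : ℕ}
    (hu : u ∈ rightDegreeLT K D (m + 1)) (hv : v ∈ rightDegreeLT K D (n + 1)) :
    u * v ∈ rightDegreeLT K D (m + n + 1) := by
  have h := Submodule.mul_mem_mul hu hv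
  rw [rightDegreeLT, rightDegreeLT, Submodule.span_mul_span] at h
  refine Submodule.span_le.mpr ?_ h
  rintro _ ⟨_, ⟨x, l, hl, rfl⟩, _, ⟨y, l', hl', rfl⟩, rfl⟩
  refine Submodule.subset_span ⟨x * y, l ++ l', ?_, ?_⟩
  · rw [PTree.weightList_eq, List.map_append, List.sum_append, ← PTree.weightList_eq,
      ← PTree.weightList_eq]
    omega
  · simp [ofForest]

theorem rightDegreeLT_mono {m n : ℕ} (h : m ≤ n) : rightDegreeLT K D m ≤ rightDegreeLT K D n :=
  Submodule.span_mono fun _ ⟨x, l, hl, hu⟩ => ⟨x, l, hl.trans_le h, hu⟩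

/-- The only cut which leaves all the vertices in the component of the root is the empty one. -/
theorem comulPTree_sub_mem (t : PTree D) :
    comulPTree K t - 1 ⊗ₜ[K] ofPTree K t ∈ rightDegreeLT K D t.weight := by
  induction t using PTree.induction with
  | h d l ih =>
    have hl : comul K (ofForest K l) - 1 ⊗ₜ[K] ofForest K l ∈
        rightDegreeLT K D (PTree.weightList l) := by
      rw [comul_ofForest]
      clear d
      induction l with
      | nil => simp [Algebra.TensorProduct.one_def]
      | cons s l ihl =>
        have h1 := ih s (by simp)
        have h2 := ihl fun s' hs' => ih s' (by simp [hs'])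
        have hone : ∀ l : List (PTree D), (1 : TreeAlgebra K D) ⊗ₜ[K] ofForest K l ∈
            rightDegreeLT K D (PTree.weightList l + 1) :=
          fun l => Submodule.subset_span ⟨1, l, Nat.lt_succ_self _, rfl⟩
        have hpos := s.weight_pos
        have e : (List.map (comulPTree K) (s :: l)).prod - 1 ⊗ₜ[K] ofForest K (s :: l) =
            (comulPTree K s - 1 ⊗ₜ[K] ofPTree K s) *
                ((List.map (comulPTree K) l).prod - 1 ⊗ₜ[K] ofForest K l) +
              (comulPTree K s - 1 ⊗ₜ[K] ofPTree K s) * (1 ⊗ₜ[K] ofForest K l) +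
              (1 ⊗ₜ[K] ofPTree K s) *
                ((List.map (comulPTree K) l).prod - 1 ⊗ₜ[K] ofForest K l) := by
          have hm : (1 : TreeAlgebra K D) ⊗ₜ[K] ofForest K (s :: l) =
              (1 ⊗ₜ[K] ofPTree K s) * (1 ⊗ₜ[K] ofForest K l) := by simp
          rw [hm, List.map_cons, List.prod_cons]
          ring
        obtain ⟨w, hw⟩ := Nat.exists_eq_succ_of_ne_zero hpos.ne'
        have h1' : comulPTree K s - 1 ⊗ₜ[K] ofPTree K s ∈ rightDegreeLT K D (w + 1) := by
          rwa [hw] at h1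
        have hs1 : (1 : TreeAlgebra K D) ⊗ₜ[K] ofPTree K s ∈ rightDegreeLT K D (w + 1 + 1) := by
          have := hone [s]
          simpa [PTree.weightList, hw] using this
        have hwl : PTree.weightList (s :: l) = w + PTree.weightList l + 1 := by
          rw [PTree.weightList, hw]; omega
        rw [e, hwl]
        refine Submodule.add_mem _ (Submodule.add_mem _ ?_ ?_) ?_
        · exact mul_mem_rightDegreeLT K h1' (rightDegreeLT_mono K (Nat.le_succ _) h2)
        · exact mul_mem_rightDegreeLT K h1' (hone l)
        · rcases Nat.eq_zero_or_pos (PTree.weightList l) with h0 | h0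
          · rw [h0, rightDegreeLT] at h2
            simp only [Nat.not_lt_zero, false_and, exists_false, Set.ofPred_false,
              Submodule.span_empty, Submodule.mem_bot] at h2
            rw [h2, mul_zero]
            exact Submodule.zero_mem _
          · obtain ⟨w', hw'⟩ := Nat.exists_eq_succ_of_ne_zero h0.ne'
            rw [hw'] at h2 ⊢
            have := mul_mem_rightDegreeLT K hs1 h2
            rwa [show w + 1 + w' + 1 = w + w'.succ + 1 by omega] at this
    have hb : ∀ u ∈ rightDegreeLT K D (PTree.weightList l),
        (Bplus K d).lTensor (TreeAlgebra K D) u ∈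
          rightDegreeLT K D (PTree.weight (.node d l)) := by
      intro u hu
      refine (Submodule.span_le (p := (rightDegreeLT K D (PTree.weight (.node d l))).comap
        ((Bplus K d).lTensor (TreeAlgebra K D)))).mpr ?_ hu
      rintro _ ⟨x, m, hm, rfl⟩
      refine Submodule.subset_span ⟨x, [.node d m], ?_, ?_⟩
      · simpa [PTree.weightList, PTree.weight] using hm
      · simp [Bplus_ofForest]
    have h3 := hb _ hl
    rw [map_sub, LinearMap.lTensor_tmul, Bplus_ofForest, comul_ofForest] at h3
    rw [comulPTree_node, add_sub_assoc]
    refine Submodule.add_mem _ (Submodule.subset_span ⟨_, [], ?_, rfl⟩) h3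
    simp [PTree.weight, PTree.weightList]

/-- Up to the term `ψ(t)` of the empty cut, the convolution product `φ * ψ` at `t` only depends on
the values of `ψ` at smaller trees. -/
theorem conv_sub_eq (φ : TreeAlgebra K D →ₐ[K] TreeAlgebra K D)
    {ψ ψ' : TreeAlgebra K D →ₐ[K] TreeAlgebra K D} (t : PTree D)
    (h : ∀ s : PTree D, s.weight < t.weight → ψ (ofPTree K s) = ψ' (ofPTree K s)) :
    conv φ ψ (ofPTree K t) - ψ (ofPTree K t) = conv φ ψ' (ofPTree K t) - ψ' (ofPTree K t) := by
  have h1 : ∀ χ : TreeAlgebra K D →ₐ[K] TreeAlgebra K D,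
      conv φ χ (ofPTree K t) - χ (ofPTree K t) =
        ((Algebra.TensorProduct.lmul' K).comp (Algebra.TensorProduct.map φ χ)).toLinearMap
          (comulPTree K t - 1 ⊗ₜ[K] ofPTree K t) := by
    intro χ
    rw [map_sub]
    simp [conv, comul_ofPTree]
    rfl
  rw [h1, h1]
  refine LinearMap.eqOn_span (s := {u | ∃ x l, PTree.weightList l < t.weight ∧
    u = x ⊗ₜ[K] ofForest K l}) ?_ (comulPTree_sub_mem K t)
  rintro _ ⟨x, l, hl, rfl⟩
  have h2 : ψ (ofForest K l) = ψ' (ofForest K l) := by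
    rw [ofForest, map_list_prod, map_list_prod, List.map_map, List.map_map]
    refine congrArg List.prod (List.map_congr_left fun s hs => h s ?_)
    exact (PTree.weight_le_weightList hs).trans_lt hl
  simp [h2]

/-- Successive approximations of the right inverse of `φ` for the convolution product. -/
noncomputable def approxInverse (φ : TreeAlgebra K D →ₐ[K] TreeAlgebra K D) :
    ℕ → (TreeAlgebra K D →ₐ[K] TreeAlgebra K D)
  | 0 => AlgHom.id K _
  | n + 1 => MvPolynomial.aeval fun t : RTree D =>
      approxInverse φ n (MvPolynomial.X t) - conv φ (approxInverse φ n) (MvPolynomial.X t)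

theorem approxInverse_succ (φ : TreeAlgebra K D →ₐ[K] TreeAlgebra K D) (n : ℕ) (t : PTree D) :
    approxInverse K φ (n + 1) (ofPTree K t) =
      approxInverse K φ n (ofPTree K t) - conv φ (approxInverse K φ n) (ofPTree K t) := by
  rw [approxInverse, ofPTree, MvPolynomial.aeval_X]

theorem conv_approxInverse (φ : TreeAlgebra K D →ₐ[K] TreeAlgebra K D) (n : ℕ) (t : PTree D)
    (ht : t.weight ≤ n) : conv φ (approxInverse K φ n) (ofPTree K t) = 0 := by
  induction n generalizing t with
  | zero => have := t.weight_pos; omega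
  | succ n ih =>
    have h := conv_sub_eq K φ (ψ := approxInverse K φ (n + 1)) (ψ' := approxInverse K φ n) t
      fun s hs => by rw [approxInverse_succ, ih s (by omega), sub_zero]
    rw [approxInverse_succ] at h
    linear_combination h

theorem approxInverse_eq (φ : TreeAlgebra K D →ₐ[K] TreeAlgebra K D) {n m : ℕ} (h : n ≤ m)
    (t : PTree D) (ht : t.weight ≤ n) :
    approxInverse K φ m (ofPTree K t) = approxInverse K φ n (ofPTree K t) := by
  induction m, h using Nat.le_induction with
  | base => rfl
  | succ m hm ih =>
    rw [approxInverse_succ, conv_approxInverse K φ m t (ht.trans hm), sub_zero, ih]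

theorem exists_right_inverse (φ : TreeAlgebra K D →ₐ[K] TreeAlgebra K D) :
    ∃ ψ, conv φ ψ = (Algebra.ofId K (TreeAlgebra K D)).comp (counitHom K) := by
  let ψ : TreeAlgebra K D →ₐ[K] TreeAlgebra K D :=
    MvPolynomial.aeval fun t : RTree D => approxInverse K φ t.weight (MvPolynomial.X t)
  have hψ : ∀ t : PTree D, ψ (ofPTree K t) = approxInverse K φ t.weight (ofPTree K t) := by
    intro t
    simp only [ψ, ofPTree, MvPolynomial.aeval_X, RTree.weight_mk]
  refine ⟨ψ, algHom_ext_node fun d l _ => ?_⟩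
  have h := conv_sub_eq K φ (ψ := ψ) (ψ' := approxInverse K φ (PTree.weight (.node d l)))
    (.node d l) fun s hs => by rw [hψ, approxInverse_eq K φ hs.le s le_rfl]
  rw [conv_approxInverse K φ _ _ le_rfl, hψ] at h
  rw [AlgHom.comp_apply, counitHom_apply, constantCoeff_ofPTree, map_zero]
  linear_combination h

theorem exists_antipode :
    ∃ S : TreeAlgebra K D →ₐ[K] TreeAlgebra K D, IsAntipode K S.toLinearMap := by
  let _ : Bialgebra K (TreeAlgebra K D) := treeBialgebra K
  obtain ⟨S, hS⟩ := exists_right_inverse K (AlgHom.id K (TreeAlgebra K D))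
  obtain ⟨S', hS'⟩ := exists_right_inverse K S
  have e1 : WithConv.toConv (AlgHom.id K (TreeAlgebra K D)) * WithConv.toConv S = 1 :=
    congrArg WithConv.toConv hS
  have e2 : WithConv.toConv S * WithConv.toConv S' = 1 := congrArg WithConv.toConv hS'
  have e3 : AlgHom.id K (TreeAlgebra K D) = S' :=
    congrArg WithConv.ofConv (left_inv_eq_right_inv e1 e2)
  rw [← e3] at hS'
  refine ⟨S, fun x => ?_, fun x => ?_⟩
  · have h := DFunLike.congr_fun hS' x
    rw [AlgHom.comp_apply, counitHom_apply] at h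
    exact h
  · have h := DFunLike.congr_fun hS x
    rw [AlgHom.comp_apply, counitHom_apply] at h
    exact h

end Antipode

/-! ### Fixed points and the solution of the system -/

section Solution

/-- Each coefficient of a fixed point is determined by the previous ones. -/
theorem eq_of_fixedPoint {K I R : Type*} [Field K] [Finite I] [CommRing R] [Algebra K R]
    (F : I → MvPowerSeries I K) (β : I → R → R) {Y Z : I → PowerSeries R}
    (hY : ∀ k, PowerSeries.constantCoeff (Y k) = 0)
    (h0 : ∀ k, PowerSeries.constantCoeff (Z k) = 0) (W : I → PowerSeries R)
    (hYβ : ∀ i n, PowerSeries.coeff (n + 1) (Y i) = PowerSeries.coeff (n + 1) (W i) +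
      β i (PowerSeries.coeff n (MvPowerSeries.subst Y (F i) : PowerSeries R)))
    (hZβ : ∀ i n, PowerSeries.coeff (n + 1) (Z i) = PowerSeries.coeff (n + 1) (W i) +
      β i (PowerSeries.coeff n (MvPowerSeries.subst Z (F i) : PowerSeries R))) : Y = Z := by
  have key : ∀ n, ∀ i, PowerSeries.coeff n (Y i) = PowerSeries.coeff n (Z i) := by
    intro n
    induction n using Nat.strong_induction_on with
    | _ n ih =>
      intro i
      rcases n with _ | n
      · rw [PowerSeries.coeff_zero_eq_constantCoeff_apply,
          PowerSeries.coeff_zero_eq_constantCoeff_apply, hY, h0]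
      · rw [hYβ, hZβ, coeff_subst_congr_left hY h0 (F i) fun m hm k => ih m (by omega) k]
  funext i
  ext n
  exact key n i

variable {K I : Type*} [Field K]

theorem coeff_zero_BplusHat (d : I) (x : PowerSeries (TreeAlgebra K I)) :
    PowerSeries.coeff 0 (BplusHat d x) = 0 := by
  rw [BplusHat, PowerSeries.coeff_mk]
  rfl

theorem coeff_succ_BplusHat (d : I) (x : PowerSeries (TreeAlgebra K I)) (n : ℕ) :
    PowerSeries.coeff (n + 1) (BplusHat d x) = Bplus K d (PowerSeries.coeff n x) := by
  rw [BplusHat, PowerSeries.coeff_mk]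

theorem constantCoeff_BplusHat (d : I) (x : PowerSeries (TreeAlgebra K I)) :
    PowerSeries.constantCoeff (BplusHat d x) = 0 := by
  rw [← PowerSeries.coeff_zero_eq_constantCoeff_apply, coeff_zero_BplusHat]

theorem IsSolution.constantCoeff_eq {F : I → MvPowerSeries I K}
    {X : I → PowerSeries (TreeAlgebra K I)} (hX : IsSolution F X) (i : I) :
    PowerSeries.constantCoeff (X i) = 0 := by
  rw [hX.2 i, constantCoeff_BplusHat]

theorem IsSolution.coeff_succ {F : I → MvPowerSeries I K}
    {X : I → PowerSeries (TreeAlgebra K I)} (hX : IsSolution F X) (i : I) (n : ℕ) :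
    PowerSeries.coeff (n + 1) (X i) = Bplus K i
      (PowerSeries.coeff n (MvPowerSeries.subst X (F i) : PowerSeries (TreeAlgebra K I))) := by
  conv_lhs => rw [hX.2 i]
  rw [coeff_succ_BplusHat]

theorem isGraded_subst [Finite I] {Y : I → PowerSeries (TreeAlgebra K I)}
    (hY : ∀ k, PowerSeries.constantCoeff (Y k) = 0) (hg : ∀ k, IsGraded (Y k))
    (F : MvPowerSeries I K) : IsGraded (MvPowerSeries.subst Y F) := by
  have key : ∀ q : MvPolynomial I K, IsGraded (MvPolynomial.aeval Y q) := by
    intro q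
    induction q using MvPolynomial.induction_on with
    | C a =>
      intro n
      rw [MvPolynomial.aeval_C, PowerSeries.algebraMap_apply, PowerSeries.coeff_C]
      split_ifs with h
      · rw [h]
        exact MvPolynomial.isWeightedHomogeneous_C _ _
      · exact MvPolynomial.isWeightedHomogeneous_zero K _ _
    | add p q hp hq => intro n; rw [map_add, map_add]; exact (hp n).add (hq n)
    | mul_X p k hp =>
      intro n
      rw [map_mul, PowerSeries.coeff_mul, MvPolynomial.aeval_X]
      refine MvPolynomial.IsWeightedHomogeneous.sum _ _ _ fun c hc => ?_
      rw [← Finset.HasAntidiagonal.mem_antidiagonal.mp hc]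
      exact (hp _).mul (hg k _)
  intro n
  rw [coeff_subst_eq_aeval_truncTotal hY F n.lt_succ_self]
  exact key _ n

theorem isGraded_BplusHat (d : I) {x : PowerSeries (TreeAlgebra K I)} (hx : IsGraded x) :
    IsGraded (BplusHat d x) := by
  rintro (_ | n)
  · rw [coeff_zero_BplusHat]
    exact MvPolynomial.isWeightedHomogeneous_zero K _ _
  · rw [coeff_succ_BplusHat]
    exact isWeightedHomogeneous_Bplus K d (hx n)

/-- Picard iterations, which approach the solution. -/
noncomputable def picard (F : I → MvPowerSeries I K) : ℕ → I → PowerSeries (TreeAlgebra K I)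
  | 0 => fun _ => 0
  | n + 1 => fun i => BplusHat i (MvPowerSeries.subst (picard F n) (F i))

theorem coeff_succ_picard (F : I → MvPowerSeries I K) (n k : ℕ) (i : I) :
    PowerSeries.coeff (k + 1) (picard F (n + 1) i) = Bplus K i (PowerSeries.coeff k
      (MvPowerSeries.subst (picard F n) (F i) : PowerSeries (TreeAlgebra K I))) :=
  coeff_succ_BplusHat _ _ _

theorem constantCoeff_picard (F : I → MvPowerSeries I K) (n : ℕ) (i : I) :
    PowerSeries.constantCoeff (picard F n i) = 0 := by
  rcases n with _ | n
  · exact map_zero _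
  · exact constantCoeff_BplusHat _ _

theorem isGraded_picard [Finite I] (F : I → MvPowerSeries I K) (n : ℕ) (i : I) :
    IsGraded (picard F n i) := by
  induction n generalizing i with
  | zero =>
    intro m
    exact MvPolynomial.isWeightedHomogeneous_zero K _ _
  | succ n ih => exact isGraded_BplusHat i (isGraded_subst (constantCoeff_picard F n) ih _)

theorem coeff_picard_succ [Finite I] (F : I → MvPowerSeries I K) {n k : ℕ} (h : k ≤ n) (i : I) :
    PowerSeries.coeff k (picard F (n + 1) i) = PowerSeries.coeff k (picard F n i) := by
  induction n generalizing k i with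
  | zero =>
    obtain rfl : k = 0 := by omega
    rw [PowerSeries.coeff_zero_eq_constantCoeff_apply,
      PowerSeries.coeff_zero_eq_constantCoeff_apply, constantCoeff_picard, constantCoeff_picard]
  | succ n ih =>
    rcases k with _ | k
    · rw [PowerSeries.coeff_zero_eq_constantCoeff_apply,
        PowerSeries.coeff_zero_eq_constantCoeff_apply, constantCoeff_picard, constantCoeff_picard]
    · rw [coeff_succ_picard, coeff_succ_picard]
      refine congrArg (Bplus K i) ?_
      exact coeff_subst_congr_left (constantCoeff_picard F _) (constantCoeff_picard F _) _
        fun m hm l => ih (by omega) l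

theorem coeff_picard_eq [Finite I] (F : I → MvPowerSeries I K) {n m : ℕ} (h : n ≤ m) (i : I) :
    PowerSeries.coeff n (picard F m i) = PowerSeries.coeff n (picard F n i) := by
  induction m, h using Nat.le_induction with
  | base => rfl
  | succ m hm ih => rw [coeff_picard_succ F hm, ih]

theorem exists_isSolution [Finite I] (F : I → MvPowerSeries I K) :
    ∃ X : I → PowerSeries (TreeAlgebra K I), IsSolution F X := by
  let X : I → PowerSeries (TreeAlgebra K I) := fun i =>
    PowerSeries.mk fun n => PowerSeries.coeff n (picard F n i)
  have hX : ∀ i n, PowerSeries.coeff n (X i) = PowerSeries.coeff n (picard F n i) := by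
    intro i n
    rw [PowerSeries.coeff_mk]
  have h0 : ∀ i, PowerSeries.constantCoeff (X i) = 0 := by
    intro i
    rw [← PowerSeries.coeff_zero_eq_constantCoeff_apply, hX,
      PowerSeries.coeff_zero_eq_constantCoeff_apply, constantCoeff_picard]
  refine ⟨X, fun i n => ?_, fun i => ?_⟩
  · rw [hX]
    exact isGraded_picard F n i n
  · ext n : 1
    rcases n with _ | n
    · rw [coeff_zero_BplusHat, PowerSeries.coeff_zero_eq_constantCoeff_apply, h0]
    · rw [coeff_succ_BplusHat, hX, coeff_succ_picard]
      refine congrArg (Bplus K i) ?_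
      exact coeff_subst_congr_left (constantCoeff_picard F _) h0 _
        fun m hm l => by rw [hX, coeff_picard_eq F hm]

end Solution

/-! ### The two conditions are sufficient -/

section Sufficient

variable {K I : Type*} [Field K] [Fintype I] {F : I → MvPowerSeries I K} {lam : ℕ → I → I → K}

/-- If all the linear terms of `F_i` vanish, then the recursion makes `F_i` constant. -/
theorem exists_a₁_ne_zero_of_coeffRecursion (h1 : CoeffRecursion F lam)
    (hF : ∀ i, ∀ c : K, F i ≠ MvPowerSeries.C c) (i : I) : ∃ d, a₁ F i d ≠ 0 := by
  classical
  by_contra! h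
  refine hF i (MvPowerSeries.constantCoeff (F i)) ?_
  have key : ∀ n, ∀ p : I →₀ ℕ, p.degree = n + 1 → a F i p = 0 := by
    intro n
    induction n using Nat.strong_induction_on with
    | _ n ih =>
      intro p hp
      have hp0 : p ≠ 0 := by rintro rfl; simp at hp
      obtain ⟨l, hl⟩ := Finsupp.ne_iff.mp hp0
      have hle : Finsupp.single l 1 ≤ p := by
        rw [Finsupp.single_le_iff]
        exact Nat.one_le_iff_ne_zero.mpr hl
      have hpl : p - Finsupp.single l 1 + Finsupp.single l 1 = p := tsub_add_cancel_of_le hle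
      have hdeg := congrArg Finsupp.degree hpl
      rw [map_add, Finsupp.degree_single, hp] at hdeg
      rcases n with _ | n
      · have hq : p - Finsupp.single l 1 = 0 := (Finsupp.degree_eq_zero_iff _).mp (by omega)
        rw [← hpl, hq, zero_add]
        exact h l
      · rw [← hpl, h1, ih n n.lt_succ_self _ (by omega), mul_zero]
  ext p
  rw [MvPowerSeries.coeff_C]
  split_ifs with hp
  · rw [hp]
    rfl
  · have hpd : p.degree ≠ 0 := fun h0 => hp ((Finsupp.degree_eq_zero_iff p).mp h0)
    exact key (p.degree - 1) p (by omega)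

variable [CharZero K] [DecidableEq I]

/-- The coproduct formula `Δ(X_i) = X_i ⊗ 1 + ∑ₙ P_n^{(i)}(X) ⊗ X_i(n + 1)`, where the
`P_n^{(i)}` are the transfer series. -/
theorem coeff_comul_solution (hF : ∀ i, MvPowerSeries.constantCoeff (F i) = 1)
    (h1 : CoeffRecursion F lam) (h2 : Additivity F lam) {d : I → I}
    (hd : ∀ i, a₁ F i (d i) ≠ 0) {X : I → PowerSeries (TreeAlgebra K I)} (hX : IsSolution F X)
    (i : I) (N : ℕ) :
    comul K (PowerSeries.coeff (N + 1) (X i)) = PowerSeries.coeff (N + 1) (X i) ⊗ₜ[K] 1 +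
      ∑ c ∈ Finset.HasAntidiagonal.antidiagonal N,
        PowerSeries.coeff c.1
            (MvPowerSeries.subst X (transfer F d c.2 i) : PowerSeries (TreeAlgebra K I)) ⊗ₜ[K]
          PowerSeries.coeff (c.2 + 1) (X i) := by
  have hX0 := hX.constantCoeff_eq
  let ι₁ : TreeAlgebra K I →ₐ[K] TreeAlgebra K I ⊗[K] TreeAlgebra K I :=
    Algebra.TensorProduct.includeLeft
  let ι₂ : TreeAlgebra K I →ₐ[K] TreeAlgebra K I ⊗[K] TreeAlgebra K I :=
    Algebra.TensorProduct.includeRight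
  let Z : I → PowerSeries (TreeAlgebra K I ⊗[K] TreeAlgebra K I) := fun k =>
    PowerSeries.map (ι₁ : TreeAlgebra K I →+* TreeAlgebra K I ⊗[K] TreeAlgebra K I) (X k)
  have hmap : ∀ (φ : TreeAlgebra K I →ₐ[K] TreeAlgebra K I ⊗[K] TreeAlgebra K I) (k : I),
      PowerSeries.constantCoeff (PowerSeries.map
        (φ : TreeAlgebra K I →+* TreeAlgebra K I ⊗[K] TreeAlgebra K I) (X k)) = 0 := by
    intro φ k
    rw [← PowerSeries.coeff_zero_eq_constantCoeff_apply, PowerSeries.coeff_map,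
      PowerSeries.coeff_zero_eq_constantCoeff_apply, hX0, map_zero]
  have hZ : ∀ k, PowerSeries.constantCoeff (Z k) = 0 := hmap ι₁
  have hterm : ∀ (k : I) (v : ℕ → TreeAlgebra K I) (N : ℕ), PowerSeries.coeff N
      (twist (fun n => MvPowerSeries.subst Z (transfer F d n k)) fun n => ι₂ (v n)) =
      ∑ c ∈ Finset.HasAntidiagonal.antidiagonal N,
        PowerSeries.coeff c.1
            (MvPowerSeries.subst X (transfer F d c.2 k) : PowerSeries (TreeAlgebra K I)) ⊗ₜ[K]
          v c.2 := by
    intro k v N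
    rw [twist, PowerSeries.coeff_mk]
    refine Finset.sum_congr rfl fun c _ => ?_
    rw [← map_subst_algHom hX0, PowerSeries.coeff_map]
    simp [ι₁, ι₂]
  let Y : I → PowerSeries (TreeAlgebra K I ⊗[K] TreeAlgebra K I) := fun k =>
    Z k + PowerSeries.X * twist (fun n => MvPowerSeries.subst Z (transfer F d n k))
      fun n => ι₂ (PowerSeries.coeff (n + 1) (X k))
  -- both series are fixed points of the operator `Y ↦ X ⊗ 1 + (id ⊗ B⁺) (F (Y))`
  have hY : (fun k => PowerSeries.map
      ((comul K : TreeAlgebra K I →ₐ[K] _) :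
        TreeAlgebra K I →+* TreeAlgebra K I ⊗[K] TreeAlgebra K I) (X k)) = Y := by
    refine eq_of_fixedPoint F (fun i => (Bplus K i).lTensor (TreeAlgebra K I)) (hmap (comul K))
      (fun k => by simp [Y, hZ]) Z (fun i n => ?_) fun i n => ?_
    · rw [← map_subst_algHom hX0, PowerSeries.coeff_map, PowerSeries.coeff_map, hX.coeff_succ,
        RingHom.coe_coe, comul_Bplus, ← hX.coeff_succ, PowerSeries.coeff_map]
      rfl
    · rw [subst_add_twist hF h1 h2 hd ι₂ Z hZ X hX0 i, hterm, map_add,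
        PowerSeries.coeff_succ_X_mul, hterm, map_sum]
      congr 1
      refine Finset.sum_congr rfl fun c _ => ?_
      rw [LinearMap.lTensor_tmul, hX.coeff_succ]
  have h3 := congrArg (PowerSeries.coeff (N + 1)) (congrFun hY i)
  rw [PowerSeries.coeff_map, map_add, PowerSeries.coeff_succ_X_mul, hterm,
    PowerSeries.coeff_map] at h3
  exact h3

theorem isHopf_of_conditions (hF_nonconst : ∀ i, ∀ c : K, F i ≠ MvPowerSeries.C c)
    (hF : ∀ i, MvPowerSeries.constantCoeff (F i) = 1)
    (h1 : CoeffRecursion F lam) (h2 : Additivity F lam) : IsHopf F := by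
  choose d hd using exists_a₁_ne_zero_of_coeffRecursion h1 hF_nonconst
  obtain ⟨X, hX⟩ := exists_isSolution F
  refine ⟨X, hX, ?_⟩
  set A := generatedSubalgebra X with hA
  have hXA : ∀ i n, PowerSeries.coeff n (X i) ∈ A := fun i n =>
    Algebra.subset_adjoin ⟨i, n, rfl⟩
  have hX0 := hX.constantCoeff_eq
  have hP : ∀ i n m, PowerSeries.coeff m
      (MvPowerSeries.subst X (transfer F d n i) : PowerSeries (TreeAlgebra K I)) ∈ A :=
    fun i n m => coeff_subst_mem hX0 A hXA _ m
  have hcomul := coeff_comul_solution hF h1 h2 hd hX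
  constructor
  · have hle : A ≤ (Algebra.TensorProduct.map A.val A.val).range.comap (comul K) := by
      rw [hA, generatedSubalgebra, Algebra.adjoin_le_iff]
      rintro _ ⟨i, n, rfl⟩
      have htmul : ∀ x ∈ A, ∀ y ∈ A,
          x ⊗ₜ[K] y ∈ (Algebra.TensorProduct.map A.val A.val).range :=
        fun x hx y hy => ⟨(⟨x, hx⟩ : A) ⊗ₜ[K] (⟨y, hy⟩ : A), rfl⟩
      change comul K _ ∈ (Algebra.TensorProduct.map A.val A.val).range
      rcases n with _ | N
      · rw [PowerSeries.coeff_zero_eq_constantCoeff_apply, hX0, map_zero]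
        exact Subalgebra.zero_mem _
      · rw [hcomul]
        exact Subalgebra.add_mem _ (htmul _ (hXA _ _) _ A.one_mem)
          (Subalgebra.sum_mem _ fun c _ => htmul _ (hP _ _ _) _ (hXA _ _))
    exact fun x hx => hle hx
  · obtain ⟨S, hS⟩ := exists_antipode K (D := I)
    refine ⟨S.toLinearMap, hS, ?_⟩
    have hle : A ≤ A.comap S := by
      conv_lhs => rw [hA, generatedSubalgebra]
      rw [Algebra.adjoin_le_iff]
      rintro _ ⟨i, n, rfl⟩
      change S _ ∈ A
      induction n using Nat.strong_induction_on with
      | _ n ih =>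
        rcases n with _ | N
        · rw [PowerSeries.coeff_zero_eq_constantCoeff_apply, hX0, map_zero]
          exact A.zero_mem
        · have h3 := hS.2 (PowerSeries.coeff (N + 1) (X i))
          rw [hcomul, hX.coeff_succ, constantCoeff_Bplus, map_zero, ← hX.coeff_succ, map_add,
            map_add, map_sum, map_sum] at h3
          simp only [TensorProduct.map_tmul, LinearMap.id_apply, LinearMap.mul'_apply,
            AlgHom.toLinearMap_apply, map_one, mul_one] at h3
          have hmem : ((0, N) : ℕ × ℕ) ∈ Finset.HasAntidiagonal.antidiagonal N := by simp
          rw [← Finset.add_sum_erase _ _ hmem, PowerSeries.coeff_zero_eq_constantCoeff_apply,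
            constantCoeff_subst_eq hX0, constantCoeff_transfer hF hd, map_one, one_mul,
            add_left_comm] at h3
          rw [eq_neg_of_add_eq_zero_left h3]
          refine A.neg_mem (A.add_mem (hXA _ _) (A.sum_mem fun c hc => ?_))
          obtain ⟨hne, hc⟩ := Finset.mem_erase.mp hc
          have hcN := Finset.HasAntidiagonal.mem_antidiagonal.mp hc
          have hlt : c.2 < N := by
            rcases Nat.eq_zero_or_pos c.1 with h0 | h0
            · exact absurd (Prod.ext h0 (by simpa [h0] using hcN)) hne
            · omega
          exact A.mul_mem (hP _ _ _) (ih (c.2 + 1) (by omega))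
    exact fun x hx => hle hx

end Sufficient

/-! ### Removing a leaf -/

section LeafDerivation

variable (K : Type*) {D : Type*} [Field K]

/-- The contraction `x ⊗ y ↦ x(•_j) y`, where `x(•_j)` is the coefficient in `x` of the tree with a
single vertex, decorated by `j`. -/
noncomputable def leafContraction (j : D) :
    TreeAlgebra K D ⊗[K] TreeAlgebra K D →ₗ[K] TreeAlgebra K D :=
  (TensorProduct.lid K (TreeAlgebra K D)).toLinearMap ∘ₗ
    (MvPolynomial.lcoeff K (Finsupp.single (RTree.mk (.node j [])) 1)).rTensor (TreeAlgebra K D)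

@[simp]
theorem leafContraction_tmul (j : D) (x y : TreeAlgebra K D) :
    leafContraction K j (x ⊗ₜ[K] y) =
      MvPolynomial.coeff (Finsupp.single (RTree.mk (.node j [])) 1) x • y := by
  simp [leafContraction]

/-- The contraction by the counit. -/
noncomputable def counitContraction :
    TreeAlgebra K D ⊗[K] TreeAlgebra K D →ₐ[K] TreeAlgebra K D :=
  ((Algebra.TensorProduct.lid K (TreeAlgebra K D)) :
      K ⊗[K] TreeAlgebra K D →ₐ[K] TreeAlgebra K D).comp
    (Algebra.TensorProduct.map (counitHom K) (AlgHom.id K (TreeAlgebra K D)))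

theorem counitContraction_tmul (x y : TreeAlgebra K D) :
    counitContraction K (x ⊗ₜ[K] y) = MvPolynomial.constantCoeff x • y := by
  simp [counitContraction, counitHom_apply]

theorem counitContraction_comul (x : TreeAlgebra K D) :
    counitContraction K (comul K x) = x := by
  have h := DFunLike.congr_fun (counit_left K (D := D)) x
  rw [AlgHom.comp_apply] at h
  rw [counitContraction, AlgHom.comp_apply, h]
  simp

theorem leafContraction_mul (j : D) (u v : TreeAlgebra K D ⊗[K] TreeAlgebra K D) :
    leafContraction K j (u * v) =
      counitContraction K u * leafContraction K j v +
        counitContraction K v * leafContraction K j u := by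
  induction u using TensorProduct.induction_on with
  | zero => simp
  | add u u' hu hu' => rw [add_mul, map_add, hu, hu', map_add, map_add]; ring
  | tmul x y =>
    induction v using TensorProduct.induction_on with
    | zero => simp
    | add v v' hv hv' => rw [mul_add, map_add, hv, hv', map_add, map_add]; ring
    | tmul x' y' =>
      rw [Algebra.TensorProduct.tmul_mul_tmul, leafContraction_tmul, leafContraction_tmul,
        leafContraction_tmul, counitContraction_tmul, counitContraction_tmul, coeff_single_mul,
        add_smul, mul_smul, smul_mul_smul_comm, mul_smul, smul_mul_smul_comm, mul_comm y' y,
        smul_smul, smul_smul]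
      congr 2
      ring

/-- The derivation which sends a tree to the sum of the trees obtained by removing a leaf decorated
by `j`. -/
noncomputable def leafDerivation (j : D) : Derivation K (TreeAlgebra K D) (TreeAlgebra K D) :=
  Derivation.mk' (leafContraction K j ∘ₗ (comul K).toLinearMap) fun x y => by
    simp [leafContraction_mul, counitContraction_comul]

theorem leafDerivation_apply (j : D) (x : TreeAlgebra K D) :
    leafDerivation K j x = leafContraction K j (comul K x) := rfl

theorem leafDerivation_Bplus [DecidableEq D] (j d : D) (x : TreeAlgebra K D) :
    leafDerivation K j (Bplus K d x) =
      (if d = j then MvPolynomial.constantCoeff x • 1 else 0) +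
        Bplus K d (leafDerivation K j x) := by
  have h : ∀ u : TreeAlgebra K D ⊗[K] TreeAlgebra K D,
      leafContraction K j ((Bplus K d).lTensor (TreeAlgebra K D) u) =
        Bplus K d (leafContraction K j u) := by
    intro u
    induction u using TensorProduct.induction_on with
    | zero => simp
    | tmul x y => simp
    | add u v hu hv => simp only [map_add, hu, hv]
  rw [leafDerivation_apply, comul_Bplus, map_add, h, leafContraction_tmul,
    coeff_single_Bplus K d x (RTree.mk (.node j [])) 0 (by simp), RTree.root_mk_node,
    leafDerivation_apply, MvPolynomial.constantCoeff_eq, ite_smul, zero_smul]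
  simp only [eq_comm]

theorem isWeightedHomogeneous_leafDerivation (j : D) {x : TreeAlgebra K D} {n : ℕ}
    (hx : MvPolynomial.IsWeightedHomogeneous RTree.weight x (n + 1)) :
    MvPolynomial.IsWeightedHomogeneous RTree.weight (leafDerivation K j x) n := by
  classical
  have hforest : ∀ l : List (PTree D),
      (∀ s ∈ l, ∀ n, s.weight = n + 1 → MvPolynomial.IsWeightedHomogeneous RTree.weight
        (leafDerivation K j (ofPTree K s)) n) →
      ∀ n, PTree.weightList l = n + 1 → MvPolynomial.IsWeightedHomogeneous RTree.weight
        (leafDerivation K j (ofForest K l)) n := by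
    intro l hl
    induction l with
    | nil => intro n hn; simp [PTree.weightList] at hn
    | cons s l ih =>
      intro n hn
      obtain ⟨w, hw⟩ := Nat.exists_eq_succ_of_ne_zero s.weight_pos.ne'
      have hn' : n = w + PTree.weightList l := by rw [PTree.weightList, hw] at hn; omega
      rw [ofForest_cons, Derivation.leibniz, smul_eq_mul, smul_eq_mul]
      refine MvPolynomial.IsWeightedHomogeneous.add ?_ ?_
      · rcases l with _ | ⟨s', l⟩
        · simp only [ofForest_nil, Derivation.map_one_eq_zero, mul_zero]
          exact MvPolynomial.isWeightedHomogeneous_zero K _ _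
        · obtain ⟨w', hw'⟩ := Nat.exists_eq_succ_of_ne_zero
            (show PTree.weightList (s' :: l) ≠ 0 by
              have := s'.weight_pos; rw [PTree.weightList]; omega)
          have h1 := (isWeightedHomogeneous_ofPTree K s).mul
            (ih (fun s hs => hl s (List.mem_cons_of_mem _ hs)) w' hw')
          rwa [show s.weight + w' = n by omega] at h1
      · have h1 := (isWeightedHomogeneous_ofForest K l).mul (hl s (by simp) w hw)
        rwa [show PTree.weightList l + w = n by omega] at h1
  have htree : ∀ (s : PTree D) (n : ℕ), s.weight = n + 1 →
      MvPolynomial.IsWeightedHomogeneous RTree.weight (leafDerivation K j (ofPTree K s)) n := by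
    intro s
    induction s using PTree.induction with
    | h d l ih =>
      intro n hn
      rw [← Bplus_ofForest, leafDerivation_Bplus]
      rw [PTree.weight] at hn
      rcases l with _ | ⟨s, l⟩
      · obtain rfl : n = 0 := by simpa [PTree.weightList] using hn.symm
        rw [ofForest_nil, Derivation.map_one_eq_zero, map_zero, add_zero]
        split_ifs
        · rw [MvPolynomial.smul_eq_C_mul, mul_one]
          exact MvPolynomial.isWeightedHomogeneous_C _ _
        · exact MvPolynomial.isWeightedHomogeneous_zero K _ _
      · have h0 : MvPolynomial.constantCoeff (ofForest K (s :: l)) = 0 := by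
          rw [ofForest_cons, map_mul, constantCoeff_ofPTree, zero_mul]
        obtain ⟨w, hw⟩ := Nat.exists_eq_succ_of_ne_zero
          (show PTree.weightList (s :: l) ≠ 0 by
            have := s.weight_pos; rw [PTree.weightList]; omega)
        rw [h0, zero_smul, ite_self, zero_add, show n = w + 1 by omega]
        exact isWeightedHomogeneous_Bplus K d (hforest _ ih w hw)
  exact homogeneous_induction ((MvPolynomial.weightedHomogeneousSubmodule K RTree.weight n).comap
    (leafDerivation K j).toLinearMap) (fun l hl => hforest l (fun s _ => htree s) n hl) hx

variable {K} in
/-- A Hopf subalgebra is stable under the removal of leaves. -/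
theorem leafDerivation_mem {A : Subalgebra K (TreeAlgebra K D)}
    (hA : ∀ x ∈ A, comul K x ∈
      LinearMap.range (TensorProduct.map A.val.toLinearMap A.val.toLinearMap)) (j : D)
    {x : TreeAlgebra K D} (hx : x ∈ A) : leafDerivation K j x ∈ A := by
  obtain ⟨u, hu⟩ := hA x hx
  rw [leafDerivation_apply, ← hu]
  clear hu
  induction u using TensorProduct.induction_on with
  | zero => simp
  | tmul x y =>
    rw [TensorProduct.map_tmul, leafContraction_tmul]
    exact A.smul_mem y.2 _
  | add u v hu hv => rw [map_add, map_add]; exact A.add_mem hu hv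

/-- The elements `B⁺_d x` are linear combinations of trees, so that their partial derivatives are
scalars. -/
theorem pderiv_Bplus (t : RTree D) (d : D) (x : TreeAlgebra K D) :
    MvPolynomial.pderiv t (Bplus K d x) =
      MvPolynomial.C (MvPolynomial.coeff (Finsupp.single t 1) (Bplus K d x)) := by
  classical
  induction x using forest_induction with
  | h0 => simp
  | hadd x y hx hy => simp only [map_add, hx, hy, MvPolynomial.coeff_add]
  | hsmul r x hx =>
    rw [map_smul, Derivation.map_smul, hx, MvPolynomial.coeff_smul, smul_eq_mul, map_mul,
      MvPolynomial.smul_eq_C_mul]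
  | hf l =>
    rw [Bplus_ofForest, ofPTree, MvPolynomial.pderiv_X, MvPolynomial.coeff_X]
    by_cases h : RTree.mk (.node d l) = t
    · rw [h]; simp
    · rw [Pi.single_eq_of_ne h, if_neg (by rwa [Finsupp.single_left_inj one_ne_zero]), map_zero]

end LeafDerivation

/-! ### The two conditions are necessary -/

section Necessary

variable {K I : Type*} [Field K] {F : I → MvPowerSeries I K}
  {X : I → PowerSeries (TreeAlgebra K I)}

/-- The coefficient of the tree `t` in the solution `X`. -/
noncomputable def treeCoeff (X : I → PowerSeries (TreeAlgebra K I)) (t : RTree I) : K :=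
  MvPolynomial.coeff (Finsupp.single t 1) (PowerSeries.coeff t.weight (X t.root))

theorem IsSolution.coeff_single [DecidableEq I] (hX : IsSolution F X) (t : RTree I) (i : I)
    (n : ℕ) :
    MvPolynomial.coeff (Finsupp.single t 1) (PowerSeries.coeff n (X i)) =
      if t.root = i ∧ t.weight = n then treeCoeff X t else 0 := by
  classical
  split_ifs with h
  · rw [← h.1, ← h.2]
    rfl
  · by_contra hne
    refine h ⟨?_, ?_⟩
    · rcases n with _ | n
      · rw [PowerSeries.coeff_zero_eq_constantCoeff_apply, hX.constantCoeff_eq] at hne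
        simp at hne
      · by_contra hr
        obtain ⟨f, hf⟩ : ∃ f : RTree I →₀ ℕ, Finsupp.toMultiset f = t.branches :=
          ⟨_, Multiset.toFinsupp_toMultiset _⟩
        rw [hX.coeff_succ, coeff_single_Bplus K i _ t f hf, if_neg hr] at hne
        exact hne rfl
    · have := hX.1 i n hne
      simpa [Finsupp.weight_apply] using this

/-- The linear part of an element of the subalgebra generated by the components of the solution:
its trees with a given root and a given weight form a multiple of a component. -/
theorem exists_coeff_eq_mul (hX : IsSolution F X) (i : I) (n : ℕ) {x : TreeAlgebra K I}
    (hx : x ∈ generatedSubalgebra X) :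
    ∃ c : K, ∀ t : RTree I, t.root = i → t.weight = n →
      MvPolynomial.coeff (Finsupp.single t 1) x =
        c * MvPolynomial.coeff (Finsupp.single t 1) (PowerSeries.coeff n (X i)) := by
  classical
  rw [generatedSubalgebra] at hx
  induction hx using Algebra.adjoin_induction with
  | mem x hx =>
    obtain ⟨k, m, rfl⟩ := hx
    by_cases h : k = i ∧ m = n
    · obtain ⟨rfl, rfl⟩ := h
      exact ⟨1, fun t _ _ => (one_mul _).symm⟩
    · refine ⟨0, fun t ht hn => ?_⟩
      rw [hX.coeff_single, if_neg, zero_mul]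
      rintro ⟨h1, h2⟩
      exact h ⟨h1.symm.trans ht, h2.symm.trans hn⟩
  | algebraMap r =>
    refine ⟨0, fun t _ _ => ?_⟩
    rw [MvPolynomial.algebraMap_eq, MvPolynomial.coeff_C, if_neg, zero_mul]
    exact fun h => one_ne_zero (Finsupp.single_eq_zero.mp h.symm)
  | add x y _ _ hx hy =>
    obtain ⟨c, hc⟩ := hx
    obtain ⟨e, he⟩ := hy
    exact ⟨c + e, fun t ht hn => by rw [MvPolynomial.coeff_add, hc t ht hn, he t ht hn, add_mul]⟩
  | mul x y _ _ hx hy =>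
    obtain ⟨c, hc⟩ := hx
    obtain ⟨e, he⟩ := hy
    exact ⟨MvPolynomial.constantCoeff x * e + c * MvPolynomial.constantCoeff y, fun t ht hn => by
      rw [coeff_single_mul, hc t ht hn, he t ht hn]; ring⟩

variable [Fintype I]

theorem IsSolution.coeff_one (hX : IsSolution F X)
    (hF : ∀ i, MvPowerSeries.constantCoeff (F i) = 1) (i : I) :
    PowerSeries.coeff 1 (X i) = Bplus K i 1 := by
  have h := hX.coeff_succ i 0
  rw [PowerSeries.coeff_zero_eq_constantCoeff_apply, constantCoeff_subst_eq hX.constantCoeff_eq,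
    hF, map_one] at h
  exact h

/-- If the system is Hopf, then removing a leaf from `X_i(n + 2)` gives an element of the generated
subalgebra which is a combination of trees with `n + 1` vertices and root `i`, hence a multiple of
`X_i(n + 1)`. -/
theorem exists_leafDerivation_coeff_eq (hX : IsSolution F X)
    (hA : ∀ x ∈ generatedSubalgebra X, comul K x ∈ LinearMap.range (TensorProduct.map
      (generatedSubalgebra X).val.toLinearMap (generatedSubalgebra X).val.toLinearMap))
    (i j : I) (n : ℕ) :
    ∃ c : K, leafDerivation K j (PowerSeries.coeff (n + 2) (X i)) =
      c • PowerSeries.coeff (n + 1) (X i) := by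
  classical
  have hgr := isGraded_subst hX.constantCoeff_eq hX.1 (F i)
  have h0 : MvPolynomial.constantCoeff (PowerSeries.coeff (n + 1)
      (MvPowerSeries.subst X (F i) : PowerSeries (TreeAlgebra K I))) = 0 := by
    by_contra hne
    rw [MvPolynomial.constantCoeff_eq] at hne
    have := hgr _ hne
    simp at this
  have hD : leafDerivation K j (PowerSeries.coeff (n + 2) (X i)) =
      Bplus K i (leafDerivation K j (PowerSeries.coeff (n + 1)
        (MvPowerSeries.subst X (F i) : PowerSeries (TreeAlgebra K I)))) := by
    rw [hX.coeff_succ, leafDerivation_Bplus, h0, zero_smul, ite_self, zero_add]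
  have hmem := leafDerivation_mem hA j (x := PowerSeries.coeff (n + 2) (X i))
    (Algebra.subset_adjoin ⟨i, n + 2, rfl⟩)
  have hhom := isWeightedHomogeneous_leafDerivation K j (hX.1 i (n + 2))
  obtain ⟨c, hc⟩ := exists_coeff_eq_mul hX i (n + 1) hmem
  refine ⟨c, ?_⟩
  ext f
  rw [MvPolynomial.coeff_smul, smul_eq_mul]
  by_cases hf : ∃ t, f = Finsupp.single t 1
  · obtain ⟨t, rfl⟩ := hf
    by_cases ht : t.root = i
    · by_cases hn : t.weight = n + 1
      · exact hc t ht hn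
      · rw [hX.coeff_single, if_neg (fun h => hn h.2), mul_zero]
        by_contra hne
        refine hn ?_
        simpa [Finsupp.weight_apply] using hhom hne
    · obtain ⟨f, hf⟩ : ∃ f : RTree I →₀ ℕ, Finsupp.toMultiset f = t.branches :=
        ⟨_, Multiset.toFinsupp_toMultiset _⟩
      rw [hX.coeff_single, if_neg (fun h => ht h.1), mul_zero, hD,
        coeff_single_Bplus K i _ t f hf, if_neg ht]
  · have hf' : ∀ t, f ≠ Finsupp.single t 1 := fun t h => hf ⟨t, h⟩
    rw [hD, hX.coeff_succ, coeff_Bplus_eq_zero K i _ f hf', coeff_Bplus_eq_zero K i _ f hf',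
      mul_zero]

variable [DecidableEq I]

/-- The derivation `D_j` which removes leaves satisfies
`D_j X_i = z (δ_{ij} + ∑ₙ λ_n^{(i,j)} X_i(n) zⁿ)`. -/
theorem exists_mapDerivation_eq (hX : IsSolution F X)
    (hF : ∀ i, MvPowerSeries.constantCoeff (F i) = 1)
    (hA : ∀ x ∈ generatedSubalgebra X, comul K x ∈ LinearMap.range (TensorProduct.map
      (generatedSubalgebra X).val.toLinearMap (generatedSubalgebra X).val.toLinearMap)) :
    ∃ lam : ℕ → I → I → K, ∀ i j, mapDerivation (leafDerivation K j) (X i) =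
      PowerSeries.X * ((if i = j then 1 else 0) + scale (fun n => lam n i j) (X i)) := by
  choose c hc using exists_leafDerivation_coeff_eq hX hA
  refine ⟨fun n i j => c i j (n - 1), fun i j => ?_⟩
  ext n : 1
  rw [coeff_mapDerivation]
  rcases n with _ | _ | n
  · rw [PowerSeries.coeff_zero_eq_constantCoeff_apply, hX.constantCoeff_eq, map_zero]
    simp
  · rw [zero_add, ← zero_add 1, PowerSeries.coeff_succ_X_mul, zero_add, hX.coeff_one hF,
      leafDerivation_Bplus, Derivation.map_one_eq_zero, map_zero, add_zero, map_add, coeff_scale,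
      PowerSeries.coeff_zero_eq_constantCoeff_apply, PowerSeries.coeff_zero_eq_constantCoeff_apply,
      hX.constantCoeff_eq, smul_zero, add_zero, map_one, one_smul]
    split_ifs <;> simp
  · rw [PowerSeries.coeff_succ_X_mul, hc, map_add, coeff_scale]
    have : PowerSeries.coeff (n + 1)
        (if i = j then 1 else 0 : PowerSeries (TreeAlgebra K I)) = 0 := by
      split_ifs <;> simp [PowerSeries.coeff_one]
    rw [this, zero_add]
    rfl

/-- The solution satisfies the functional equation. -/
theorem functional_equation_of_mapDerivation {lam : ℕ → I → I → K} (hX : IsSolution F X)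
    (hD : ∀ i j, mapDerivation (leafDerivation K j) (X i) =
      PowerSeries.X * ((if i = j then 1 else 0) + scale (fun n => lam n i j) (X i))) (i j : I) :
    ∑ k, MvPowerSeries.subst X (MvPowerSeries.pderiv K k (F i)) *
        ((if k = j then 1 else 0) + scale (fun n => lam n k j) (X k)) =
      scale (fun n => lam (n + 1) i j) (MvPowerSeries.subst X (F i)) := by
  have hX0 := hX.constantCoeff_eq
  have h1 := mapDerivation_subst hX0 (leafDerivation K j) (F i)
  simp only [hD, mul_left_comm _ (PowerSeries.X : PowerSeries (TreeAlgebra K I))] at h1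
  rw [← Finset.mul_sum] at h1
  ext n : 1
  rw [← PowerSeries.coeff_succ_X_mul, ← h1, coeff_mapDerivation, coeff_scale]
  refine Bplus_injective K i ?_
  have h2 := congrArg (PowerSeries.coeff (n + 2)) (hD i j)
  have hgr := isGraded_subst hX0 hX.1 (F i)
  have h0 : MvPolynomial.constantCoeff (PowerSeries.coeff (n + 1)
      (MvPowerSeries.subst X (F i) : PowerSeries (TreeAlgebra K I))) = 0 := by
    by_contra hne
    rw [MvPolynomial.constantCoeff_eq] at hne
    have := hgr _ hne
    simp at this
  have h3 : PowerSeries.coeff (n + 1)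
      (if i = j then 1 else 0 : PowerSeries (TreeAlgebra K I)) = 0 := by
    split_ifs <;> simp [PowerSeries.coeff_one]
  rw [coeff_mapDerivation, hX.coeff_succ, leafDerivation_Bplus, h0, zero_smul, ite_self, zero_add,
    PowerSeries.coeff_succ_X_mul, map_add, h3, zero_add, coeff_scale, hX.coeff_succ] at h2
  rw [h2, map_smul]

end Necessary

/-! ### Extraction of coefficients -/

section Extraction

variable {K I : Type*} [Field K] {F : I → MvPowerSeries I K}
  {X : I → PowerSeries (TreeAlgebra K I)}

/-- The successive derivatives of a series on forests with respect to the trees of a list. -/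
noncomputable def derivTrees (L : List (RTree I)) (f : PowerSeries (TreeAlgebra K I)) :
    PowerSeries (TreeAlgebra K I) :=
  L.foldl (fun f t => mapDerivation (MvPolynomial.pderiv t) f) f

/-- The successive derivatives of a series in the `h_l` with respect to the roots of a list of
trees. -/
noncomputable def derivRoots (L : List (RTree I)) (G : MvPowerSeries I K) : MvPowerSeries I K :=
  L.foldl (fun G t => MvPowerSeries.pderiv K t.root G) G

theorem derivTrees_smul_X_pow_mul (L : List (RTree I)) (c : K) (n : ℕ)
    (f : PowerSeries (TreeAlgebra K I)) :
    derivTrees L (c • (PowerSeries.X ^ n * f)) = c • (PowerSeries.X ^ n * derivTrees L f) := by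
  induction L generalizing f with
  | nil => rfl
  | cons t L ih =>
    have h : mapDerivation (MvPolynomial.pderiv t) (c • (PowerSeries.X ^ n * f)) =
        c • (PowerSeries.X ^ n * mapDerivation (MvPolynomial.pderiv t) f) := by
      rw [Derivation.map_smul, Derivation.leibniz, mapDerivation_X_pow, smul_zero, add_zero,
        smul_eq_mul]
    change derivTrees L (mapDerivation _ _) = _
    rw [h, ih]
    rfl

/-- Up to a nonzero factor, a product of factorials, an iterated derivative at `0` is
a coefficient. -/
theorem exists_constantCoeff_derivRoots [CharZero K] (L : List (RTree I)) :
    ∃ c : K, c ≠ 0 ∧ ∀ G : MvPowerSeries I K, MvPowerSeries.constantCoeff (derivRoots L G) =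
      c * MvPowerSeries.coeff (L.map fun t => Finsupp.single t.root 1).sum G := by
  induction L with
  | nil => exact ⟨1, one_ne_zero, fun G => by simp [derivRoots]⟩
  | cons t L ih =>
    obtain ⟨c, hc, h⟩ := ih
    refine ⟨c * (((L.map fun t => Finsupp.single t.root 1).sum t.root : ℕ) + 1),
      mul_ne_zero hc (Nat.cast_add_one_ne_zero _), fun G => ?_⟩
    change MvPowerSeries.constantCoeff (derivRoots L (MvPowerSeries.pderiv K t.root G)) = _
    rw [h, MvPowerSeries.coeff_pderiv, List.map_cons, List.sum_cons,
      add_comm (Finsupp.single t.root 1)]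
    ring

theorem derivRoots_pderiv (L : List (RTree I)) (j : I) (G : MvPowerSeries I K) :
    derivRoots L (MvPowerSeries.pderiv K j G) = MvPowerSeries.pderiv K j (derivRoots L G) := by
  induction L generalizing G with
  | nil => rfl
  | cons t L ih =>
    change derivRoots L (MvPowerSeries.pderiv K t.root (MvPowerSeries.pderiv K j G)) = _
    rw [pderiv_comm, ih]
    rfl

variable [DecidableEq I]

/-- Each component of the solution is a combination of trees, so that its partial derivatives are
scalars. -/
theorem mapDerivation_pderiv_solution (hX : IsSolution F X) (t : RTree I) (k : I) :
    mapDerivation (MvPolynomial.pderiv t) (X k) =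
      if k = t.root then treeCoeff X t • PowerSeries.X ^ t.weight else 0 := by
  ext n : 1
  rw [coeff_mapDerivation]
  have h : MvPolynomial.pderiv t (PowerSeries.coeff n (X k)) =
      MvPolynomial.C (MvPolynomial.coeff (Finsupp.single t 1) (PowerSeries.coeff n (X k))) := by
    rcases n with _ | n
    · rw [PowerSeries.coeff_zero_eq_constantCoeff_apply, hX.constantCoeff_eq]
      simp
    · rw [hX.coeff_succ, pderiv_Bplus]
  rw [h, hX.coeff_single]
  by_cases h1 : k = t.root
  · rw [if_pos h1, PowerSeries.coeff_smul, PowerSeries.coeff_X_pow]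
    by_cases h2 : n = t.weight
    · rw [if_pos h2, if_pos ⟨h1.symm, h2.symm⟩, MvPolynomial.smul_eq_C_mul, mul_one]
    · rw [if_neg h2, if_neg (fun h => h2 h.2.symm), map_zero, smul_zero]
  · rw [if_neg h1, if_neg (fun h => h1 h.1.symm), map_zero, map_zero]

variable [Fintype I]

theorem mapDerivation_pderiv_subst (hX : IsSolution F X) (t : RTree I) (G : MvPowerSeries I K) :
    mapDerivation (MvPolynomial.pderiv t) (MvPowerSeries.subst X G) =
      treeCoeff X t • (PowerSeries.X ^ t.weight *
        MvPowerSeries.subst X (MvPowerSeries.pderiv K t.root G)) := by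
  rw [mapDerivation_subst hX.constantCoeff_eq]
  simp only [mapDerivation_pderiv_solution hX, mul_ite, mul_zero, Finset.sum_ite_eq',
    Finset.mem_univ, if_true]
  rw [mul_smul_comm, mul_comm]

/-- Each derivative with respect to a tree `t` yields a factor `z^{|t|}`, which shifts the scalars
of `scale`. -/
theorem derivTrees_scale_subst (hX : IsSolution F X) (c : ℕ → K) (L : List (RTree I))
    (G : MvPowerSeries I K) :
    derivTrees L (scale c (MvPowerSeries.subst X G)) =
      (L.map (treeCoeff X)).prod • (PowerSeries.X ^ (L.map RTree.weight).sum *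
        scale (fun n => c (n + (L.map RTree.weight).sum))
          (MvPowerSeries.subst X (derivRoots L G))) := by
  induction L generalizing G c with
  | nil => simp [derivTrees, derivRoots]
  | cons t L ih =>
    change derivTrees L (mapDerivation _ _) = _
    rw [mapDerivation_scale, mapDerivation_pderiv_subst hX, map_smul, scale_X_pow_mul,
      derivTrees_smul_X_pow_mul, ih, List.map_cons, List.prod_cons, List.map_cons, List.sum_cons,
      mul_smul_comm, smul_smul, ← mul_assoc, ← pow_add]
    simp only [add_assoc, add_comm t.weight]
    rfl

theorem mapDerivation_pderiv_sum_subst_mul (hX : IsSolution F X) (t : RTree I)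
    (G : MvPowerSeries I K) (c m : K) {W : I → PowerSeries (TreeAlgebra K I)}
    (hW : ∀ k, mapDerivation (MvPolynomial.pderiv t) (W k) =
      if k = t.root then (treeCoeff X t * m) • PowerSeries.X ^ t.weight else 0) :
    mapDerivation (MvPolynomial.pderiv t)
        (∑ k, MvPowerSeries.subst X (MvPowerSeries.pderiv K k G) * W k +
          c • MvPowerSeries.subst X G) =
      treeCoeff X t • (PowerSeries.X ^ t.weight *
        (∑ k, MvPowerSeries.subst X
            (MvPowerSeries.pderiv K k (MvPowerSeries.pderiv K t.root G)) * W k +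
          (c + m) • MvPowerSeries.subst X (MvPowerSeries.pderiv K t.root G))) := by
  have h : ∑ k, W k * treeCoeff X t • (PowerSeries.X ^ t.weight *
        MvPowerSeries.subst X (MvPowerSeries.pderiv K t.root (MvPowerSeries.pderiv K k G))) =
      treeCoeff X t • (PowerSeries.X ^ t.weight * ∑ k, MvPowerSeries.subst X
        (MvPowerSeries.pderiv K k (MvPowerSeries.pderiv K t.root G)) * W k) := by
    rw [Finset.mul_sum, Finset.smul_sum]
    refine Finset.sum_congr rfl fun k _ => ?_
    rw [pderiv_comm, mul_smul_comm, mul_left_comm, mul_comm (W k)]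
  rw [map_add, map_sum, Derivation.map_smul]
  simp only [Derivation.leibniz, hW, smul_eq_mul, mapDerivation_pderiv_subst hX, mul_ite,
    mul_zero, Finset.sum_add_distrib, Finset.sum_ite_eq', Finset.mem_univ, if_true]
  rw [h]
  generalize MvPowerSeries.subst X (MvPowerSeries.pderiv K t.root G) = S
  generalize ∑ k, MvPowerSeries.subst X
    (MvPowerSeries.pderiv K k (MvPowerSeries.pderiv K t.root G)) * W k = T
  rw [mul_add, smul_add, add_smul, mul_add, smul_add, mul_smul_comm, mul_smul_comm, mul_smul_comm,
    smul_smul, smul_smul, smul_smul, mul_comm c, mul_comm S]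
  abel

/-- Differentiating the left-hand side of the functional equation with respect to a tree `t` adds to
it the multiple by `λ_{|t|}^{(r,j)}`, where `r` is the root of `t`: this is the contribution of
the leaves of `t`. -/
theorem derivTrees_functional_equation (hX : IsSolution F X) (lam : ℕ → I → I → K) (j : I)
    (L : List (RTree I)) (G : MvPowerSeries I K) (c : K) :
    derivTrees L (∑ k, MvPowerSeries.subst X (MvPowerSeries.pderiv K k G) *
        ((if k = j then 1 else 0) + scale (fun n => lam n k j) (X k)) +
          c • MvPowerSeries.subst X G) =
      (L.map (treeCoeff X)).prod • (PowerSeries.X ^ (L.map RTree.weight).sum *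
        (∑ k, MvPowerSeries.subst X (MvPowerSeries.pderiv K k (derivRoots L G)) *
            ((if k = j then 1 else 0) + scale (fun n => lam n k j) (X k)) +
          (c + (L.map fun t => lam t.weight t.root j).sum) •
            MvPowerSeries.subst X (derivRoots L G))) := by
  induction L generalizing G c with
  | nil => simp [derivTrees, derivRoots]
  | cons t L ih =>
    have hδ : ∀ k, mapDerivation (MvPolynomial.pderiv t)
        ((if k = j then 1 else 0) + scale (fun n => lam n k j) (X k)) =
        if k = t.root then
          (treeCoeff X t * lam t.weight t.root j) • PowerSeries.X ^ t.weight else 0 := by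
      intro k
      have h1 : mapDerivation (MvPolynomial.pderiv t)
          (if k = j then 1 else 0 : PowerSeries (TreeAlgebra K I)) = 0 := by
        split_ifs <;> simp
      rw [map_add, h1, zero_add, mapDerivation_scale, mapDerivation_pderiv_solution hX]
      split_ifs
      · have h2 := scale_X_pow_mul (R := TreeAlgebra K I) (fun n => lam n k j) 1 t.weight
        rw [mul_one] at h2
        rw [map_smul, h2, mul_smul]
        congr 1
        ext n : 1
        rw [PowerSeries.coeff_X_pow_mul', PowerSeries.coeff_smul, PowerSeries.coeff_X_pow,
          coeff_scale, PowerSeries.coeff_one]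
        by_cases h3 : n = t.weight
        · simp [h3, ‹k = t.root›]
        · by_cases h4 : t.weight ≤ n
          · rw [if_pos h4, if_neg (by omega), if_neg h3]
            simp
          · rw [if_neg h4, if_neg h3, smul_zero]
      · exact map_zero _
    change derivTrees L (mapDerivation _ _) = _
    rw [mapDerivation_pderiv_sum_subst_mul hX t G c (lam t.weight t.root j) hδ,
      derivTrees_smul_X_pow_mul, ih, List.map_cons, List.prod_cons, List.map_cons, List.sum_cons,
      List.map_cons, List.sum_cons, mul_smul_comm, smul_smul, ← mul_assoc,
      ← pow_add, add_assoc]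
    rfl

end Extraction

section Conditions

variable {K I : Type*} [Field K] {F : I → MvPowerSeries I K}
  {X : I → PowerSeries (TreeAlgebra K I)} [DecidableEq I] [Fintype I]

/-- The key relation between the coefficients of `F` and the scalars `λ`, obtained from
the functional equation by extracting the coefficient of a forest all of whose trees occur in the
solution. -/
theorem coeff_relation [CharZero K] (hX : IsSolution F X) {lam : ℕ → I → I → K} {i j : I}
    (hU : ∑ k, MvPowerSeries.subst X (MvPowerSeries.pderiv K k (F i)) *
        ((if k = j then 1 else 0) + scale (fun n => lam n k j) (X k)) =
      scale (fun n => lam (n + 1) i j) (MvPowerSeries.subst X (F i)))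
    (L : List (RTree I)) (hL : ∀ t ∈ L, treeCoeff X t ≠ 0) (p : I →₀ ℕ)
    (hp : (L.map fun t => Finsupp.single t.root 1).sum = p) :
    a F i (p + Finsupp.single j 1) * ((p j : K) + 1) +
        (L.map fun t => lam t.weight t.root j).sum * a F i p =
      lam ((L.map RTree.weight).sum + 1) i j * a F i p := by
  have hX0 := hX.constantCoeff_eq
  have hprod : (L.map (treeCoeff X)).prod ≠ 0 := by
    rw [Ne, List.prod_eq_zero_iff, List.mem_map]
    rintro ⟨t, ht, h0⟩
    exact hL t ht h0
  have h := congrArg (derivTrees L) hU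
  have h2 := derivTrees_functional_equation hX lam j L (F i) 0
  rw [zero_smul, add_zero] at h2
  rw [h2, derivTrees_scale_subst hX] at h
  have h3 := congrArg (PowerSeries.coeff (L.map RTree.weight).sum) h
  rw [PowerSeries.coeff_smul, PowerSeries.coeff_smul] at h3
  have h4 := smul_right_injective _ hprod h3
  have hc : ∀ f : PowerSeries (TreeAlgebra K I),
      PowerSeries.coeff (L.map RTree.weight).sum (PowerSeries.X ^ (L.map RTree.weight).sum * f) =
        PowerSeries.coeff 0 f := fun f => by
    simpa using PowerSeries.coeff_X_pow_mul f (L.map RTree.weight).sum 0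
  rw [hc, hc, coeff_scale, zero_add, zero_add] at h4
  simp only [PowerSeries.coeff_zero_eq_constantCoeff_apply, map_add, map_sum, map_mul] at h4
  have hs : ∀ (c : K) (G : MvPowerSeries I K), PowerSeries.constantCoeff
      (c • (MvPowerSeries.subst X G : PowerSeries (TreeAlgebra K I))) =
        algebraMap K _ (c * MvPowerSeries.constantCoeff G) := fun c G => by
    rw [← PowerSeries.coeff_zero_eq_constantCoeff_apply, PowerSeries.coeff_smul,
      PowerSeries.coeff_zero_eq_constantCoeff_apply, constantCoeff_subst_eq hX0, map_mul,
      Algebra.smul_def]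
  have hW : ∀ k, PowerSeries.constantCoeff
        (if k = j then 1 else 0 : PowerSeries (TreeAlgebra K I)) +
      PowerSeries.constantCoeff (scale (fun n => lam n k j) (X k)) = if k = j then 1 else 0 := by
    intro k
    rw [← PowerSeries.coeff_zero_eq_constantCoeff_apply (scale _ _), coeff_scale,
      PowerSeries.coeff_zero_eq_constantCoeff_apply, hX0, smul_zero, add_zero]
    split_ifs <;> simp
  simp only [hs, hW, mul_ite, mul_one, mul_zero, Finset.sum_ite_eq', Finset.mem_univ,
    if_true] at h4
  rw [constantCoeff_subst_eq hX0, constantCoeff_subst_eq hX0, Algebra.smul_def, ← map_mul,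
    ← map_add] at h4
  have h5 := (algebraMap K (TreeAlgebra K I)).injective h4
  obtain ⟨c, hc0, hc⟩ := exists_constantCoeff_derivRoots (K := K) L
  rw [← derivRoots_pderiv, hc, hc, hp, MvPowerSeries.coeff_pderiv] at h5
  refine mul_left_cancel₀ hc0 ?_
  rw [a, a]
  linear_combination h5

/-- The tree with a single vertex. -/
def leaf (d : I) : RTree I := RTree.mk (.node d [])

theorem treeCoeff_leaf (hX : IsSolution F X)
    (hF : ∀ i, MvPowerSeries.constantCoeff (F i) = 1) (d : I) : treeCoeff X (leaf d) = 1 := by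
  have h1 : (leaf d).weight = 1 := rfl
  have h2 : (leaf d).root = d := rfl
  rw [treeCoeff, h1, h2, hX.coeff_one hF, coeff_single_Bplus K d 1 (leaf d) 0 (by simp [leaf]),
    if_pos h2]
  simp

variable [CharZero K] {lam : ℕ → I → I → K}

/-- The relation `coeff_relation` for a list of trees with given roots. With trees of arbitrary
weights, all the values of `λ` appear; with single vertices, only `λ_{m+1}` and the `λ_1`. -/
theorem coeff_relation_word (hX : IsSolution F X)
    (hU : ∀ i j, ∑ k, MvPowerSeries.subst X (MvPowerSeries.pderiv K k (F i)) *
        ((if k = j then 1 else 0) + scale (fun n => lam n k j) (X k)) =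
      scale (fun n => lam (n + 1) i j) (MvPowerSeries.subst X (F i)))
    {m : ℕ} (t : Fin m → RTree I) (ht : ∀ l, treeCoeff X (t l) ≠ 0) (i j : I) (p : I →₀ ℕ)
    (hp : ∑ l, Finsupp.single (t l).root 1 = p) :
    a F i (p + Finsupp.single j 1) * ((p j : K) + 1) +
        (∑ l, lam (t l).weight (t l).root j) * a F i p =
      lam (∑ l, (t l).weight + 1) i j * a F i p := by
  have h := coeff_relation hX (hU i j) (List.ofFn t) (by
    intro s hs
    obtain ⟨l, rfl⟩ := (List.mem_ofFn' _ _).mp hs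
    exact ht l) p (by rw [List.map_ofFn, List.sum_ofFn]; exact hp)
  rw [List.map_ofFn, List.sum_ofFn, List.map_ofFn, List.sum_ofFn] at h
  exact h

theorem lam_one_eq (hX : IsSolution F X)
    (hF : ∀ i, MvPowerSeries.constantCoeff (F i) = 1)
    (hU : ∀ i j, ∑ k, MvPowerSeries.subst X (MvPowerSeries.pderiv K k (F i)) *
        ((if k = j then 1 else 0) + scale (fun n => lam n k j) (X k)) =
      scale (fun n => lam (n + 1) i j) (MvPowerSeries.subst X (F i))) (i j : I) :
    lam 1 i j = a₁ F i j := by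
  have h := coeff_relation_word hX hU (m := 0) Fin.elim0 (fun l => l.elim0) i j 0 (by simp)
  have h0 : a F i 0 = 1 := hF i
  simp only [zero_add, Finsupp.coe_zero, Pi.zero_apply, Nat.cast_zero, mul_one,
    Finset.univ_eq_empty, Finset.sum_empty, add_zero, h0] at h
  exact h.symm

theorem coeffRecursion_of_functional_equation (hX : IsSolution F X)
    (hF : ∀ i, MvPowerSeries.constantCoeff (F i) = 1)
    (hU : ∀ i j, ∑ k, MvPowerSeries.subst X (MvPowerSeries.pderiv K k (F i)) *
        ((if k = j then 1 else 0) + scale (fun n => lam n k j) (X k)) =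
      scale (fun n => lam (n + 1) i j) (MvPowerSeries.subst X (F i))) :
    CoeffRecursion F lam := by
  intro i j p
  obtain ⟨m, d, hd⟩ := exists_word p
  have h := coeff_relation_word hX hU (fun l => leaf (d l))
    (fun l => by rw [treeCoeff_leaf hX hF]; exact one_ne_zero) i j p hd
  have h1 : ∀ l, (leaf (d l)).weight = 1 := fun l => rfl
  have h2 : ∀ l, (leaf (d l)).root = d l := fun l => rfl
  have h3 : ∑ l, p l = m := by
    rw [← Finsupp.degree_eq_sum, ← hd, degree_sum_single]
  have h4 : ∑ l, (p l : K) * a₁ F l j = ∑ l, a₁ F (d l) j := by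
    rw [← hd, sum_sum_single_mul]
  simp only [h1, h2, lam_one_eq hX hF hU, Finset.sum_const, Finset.card_univ, Fintype.card_fin,
    smul_eq_mul, mul_one] at h
  have hp : ((p j : K) + 1) ≠ 0 := Nat.cast_add_one_ne_zero _
  rw [h3, h4]
  field_simp
  linear_combination h

/-- Every component of the solution contains a tree: it is enough to graft repeatedly on a root
decorated by `i` a tree whose root is decorated by some `d` such that `a^{(i)}_d ≠ 0`. -/
theorem exists_treeCoeff_ne_zero (hX : IsSolution F X)
    (hF : ∀ i, MvPowerSeries.constantCoeff (F i) = 1) (hd : ∀ i, ∃ d, a₁ F i d ≠ 0) (n : ℕ)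
    (i : I) : ∃ t : RTree I, t.root = i ∧ t.weight = n + 1 ∧ treeCoeff X t ≠ 0 := by
  classical
  induction n generalizing i with
  | zero => exact ⟨leaf i, rfl, rfl, by rw [treeCoeff_leaf hX hF]; exact one_ne_zero⟩
  | succ n ih =>
    obtain ⟨d, hd⟩ := hd i
    obtain ⟨s, rfl, hs, hne⟩ := ih d
    have hw : (RTree.mk (.node i [s.out])).weight = s.weight + 1 := by
      conv_rhs => rw [← s.mk_out]
      simp [PTree.weight, PTree.weightList]
    have hr : (RTree.mk (.node i [s.out])).root = i := rfl
    refine ⟨RTree.mk (.node i [s.out]), hr, by rw [hw, hs], ?_⟩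
    have hb : Finsupp.toMultiset (Finsupp.single s 1) =
        (RTree.mk (.node i [s.out])).branches := by
      simp [RTree.mk_out]
    rw [treeCoeff, hr, hw, hX.coeff_succ, coeff_single_Bplus K i _ _ _ hb, if_pos hr]
    have h := congrArg (fun f => MvPolynomial.constantCoeff (PowerSeries.coeff s.weight f))
      (mapDerivation_pderiv_subst hX s (F i))
    have h1 := PowerSeries.coeff_X_pow_mul (MvPowerSeries.subst X
      (MvPowerSeries.pderiv K s.root (F i)) : PowerSeries (TreeAlgebra K I)) s.weight 0
    rw [zero_add] at h1
    simp only [coeff_mapDerivation, PowerSeries.coeff_smul] at h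
    rw [h1, PowerSeries.coeff_zero_eq_constantCoeff_apply,
      constantCoeff_subst_eq hX.constantCoeff_eq, constantCoeff_pderiv,
      MvPolynomial.constantCoeff_eq, MvPolynomial.coeff_pderiv, MvPolynomial.algebraMap_eq,
      MvPolynomial.coeff_smul, MvPolynomial.coeff_C, if_pos rfl] at h
    simp only [zero_add, Finsupp.coe_zero, Pi.zero_apply, Nat.cast_zero, mul_one] at h
    rw [h]
    exact mul_ne_zero hne hd

theorem additivity_of_functional_equation (hX : IsSolution F X)
    (hF : ∀ i, MvPowerSeries.constantCoeff (F i) = 1) (hd : ∀ i, ∃ d, a₁ F i d ≠ 0)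
    (hU : ∀ i j, ∑ k, MvPowerSeries.subst X (MvPowerSeries.pderiv K k (F i)) *
        ((if k = j then 1 else 0) + scale (fun n => lam n k j) (X k)) =
      scale (fun n => lam (n + 1) i j) (MvPowerSeries.subst X (F i))) :
    Additivity F lam := by
  intro p _ i j d hne n hn
  have ht : ∀ l, ∃ t : RTree I, t.root = d l ∧ t.weight = n l ∧ treeCoeff X t ≠ 0 := fun l => by
    obtain ⟨t, h⟩ := exists_treeCoeff_ne_zero hX hF hd (n l - 1) (d l)
    rw [Nat.sub_add_cancel (hn l)] at h
    exact ⟨t, h⟩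
  choose t htr htw ht0 using ht
  have h := coeff_relation_word hX hU t ht0 i j _ rfl
  have h' := coeff_relation_word hX hU (fun l => leaf (d l))
    (fun l => by rw [treeCoeff_leaf hX hF]; exact one_ne_zero) i j _ rfl
  have h1 : ∀ l, (leaf (d l)).weight = 1 := fun l => rfl
  have h2 : ∀ l, (leaf (d l)).root = d l := fun l => rfl
  simp only [h1, h2, htr, htw, lam_one_eq hX hF hU, Finset.sum_const, Finset.card_univ,
    Fintype.card_fin, smul_eq_mul, mul_one] at h h'
  refine mul_right_cancel₀ hne ?_
  rw [Finset.sum_sub_distrib]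
  linear_combination h' - h

end Conditions

end DysonSchwinger

theorem proposition19 {K I : Type*} [Field K] [CharZero K] [Fintype I] [Nonempty I]
    (F : I → MvPowerSeries I K)
    (hF_nonconst : ∀ i, ∀ c : K, F i ≠ MvPowerSeries.C c)
    (hF_one : ∀ i, MvPowerSeries.constantCoeff (F i) = 1) :
    DysonSchwinger.IsHopf F ↔
      ∃ lam : ℕ → I → I → K,
        (∀ (i j : I) (p : I →₀ ℕ),
          DysonSchwinger.a F i (p + Finsupp.single j 1) =
            1 / ((p j : K) + 1) *
              (lam ((∑ l, p l) + 1) i j - ∑ l, (p l : K) * DysonSchwinger.a₁ F l j) *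
              DysonSchwinger.a F i p) ∧
        (∀ (p : ℕ), 1 ≤ p → ∀ (i j : I) (d : Fin p → I),
          DysonSchwinger.a F i (∑ l, Finsupp.single (d l) 1) ≠ 0 →
          ∀ n : Fin p → ℕ, (∀ l, 1 ≤ n l) →
            lam ((∑ l, n l) + 1) i j - DysonSchwinger.a₁ F i j =
              (lam (p + 1) i j - DysonSchwinger.a₁ F i j) +
                ∑ l, (lam (n l) (d l) j - DysonSchwinger.a₁ F (d l) j)) := by
  classical
  constructor
  · rintro ⟨X, hX, hA, -⟩
    obtain ⟨lam, hD⟩ := DysonSchwinger.exists_mapDerivation_eq hX hF_one hA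
    have hU := DysonSchwinger.functional_equation_of_mapDerivation hX hD
    have h1 := DysonSchwinger.coeffRecursion_of_functional_equation hX hF_one hU
    exact ⟨lam, h1, DysonSchwinger.additivity_of_functional_equation hX hF_one
      (DysonSchwinger.exists_a₁_ne_zero_of_coeffRecursion h1 hF_nonconst) hU⟩
  · rintro ⟨lam, h1, h2⟩
    exact DysonSchwinger.isHopf_of_conditions hF_nonconst hF_one h1 h2
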